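/- Let $M$ be a smooth (Hausdorff) manifold of dimension $2d+1$ with a contact form $\eta$, i.e. a smooth $1$-form with $\eta\wedge(d\eta)^d\neq 0$ everywhere. The contact Hamiltonian vector field $X_{\mathcal H}$ of a function $\mathcal H$ is the smooth vector field with $\pounds_{X_{\mathcal H}}\eta=\rho\,\eta$ for some function $\rho$ and $\iota_{X_{\mathcal H}}\eta=-\mathcal H$. Let $\mathcal H=\sum_{j=1}^N\phi_j$, and suppose that each $X_{\phi_j}$ is integrated exactly: a smooth local flow $(t,x)\mapsto e^{tX_{\phi_j}}x$ is given, defined on an open set of $\mathbb R\times M$ that contains $\{0\}\times M$, has interval slices $\{t : (t,x)\in\text{domain}\}$, and is such that $e^{-tX_{\phi_j}}$ is defined at $e^{tX_{\phi_j}}x$ and maps it back to $x$. (For complete $X_{\phi_j}$ the domain may be all of $\mathbb R\times M$.) Put $$S_2(\tau)=e^{\frac{\tau}{2}X_{\phi_1}}e^{\frac{\tau}{2}X_{\phi_2}}\cdots e^{\tau X_{\phi_N}}\cdots e^{\frac{\tau}{2}X_{\phi_2}}e^{\frac{\tau}{2}X_{\phi_1}},$$ a composition of maps between open subsets of $M$,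 defined where all the factors are. A family of maps $S(\tau)$ is a \emph{contact integrator of order $p$} for $\dot x=X_{\mathcal H}(x)$ if * near each point of $M$, locally uniformly in $x$, $S(\tau)x$ is defined for small $|\tau|$ and $S(\tau)x-e^{\tau X_{\mathcal H}}x=O(|\tau|^{p+1})$ in a chart; and * for each $\tau$, $S(\tau)$ is a diffeomorphism between open subsets of $M$ with $S(\tau)^*\eta=\rho_\tau\,\eta$ for a nowhere vanishing function $\rho_\tau$. Then contact integrators of any even order $2n$, $n\ge 1$, are obtained from $S_2$ in each of the following two ways. 1. (Exact coefficients.) Define recursively, for $n\ge1$, $$S_{2n+2}(\tau)=S_{2n}(z_1(n)\tau)\,S_{2n}(z_0(n)\tau)\,S_{2n}(z_1(n)\tau),\qquad z_0(n)=-\frac{2^{\frac1{2n+1}}}{2-2^{\frac1{2n+1}}},\quad z_1(n)=\frac1{2-2^{\frac1{2n+1}}}.$$ Then for every $n\ge1$, $S_{2n}$ is a contact integrator of order $2n$. 2. (Symmetric composition.) For every $n\ge1$ there are $m\in\mathbb N$ and real numbers $w_0,\dots,w_m$ with $w_0=1-2\sum_{j=1}^m w_j$, depending only on $n$ (not on $M$,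 $\eta$, $\mathcal H$, the $\phi_j$ or their flows), such that $$S^{(m)}(\tau)=S_2(w_m\tau)S_2(w_{m-1}\tau)\cdots S_2(w_0\tau)\cdots S_2(w_{m-1}\tau)S_2(w_m\tau)$$ is a contact integrator of order $2n$. If moreover the flows of all the $X_{\phi_j}$ are given on all of $\mathbb R\times M$, then for every $\tau$ all these maps are globally defined bijections $M\to M$, hence contactomorphisms of $M$. -/

import Mathlib

open scoped Manifold ContDiff Topology

noncomputable section

namespace ContactIntegrator

/-- The model space `ℝ^(2n+1)` of a `(2n+1)`-dimensional manifold. -/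
abbrev Model (n : ℕ) : Type := EuclideanSpace ℝ (Fin (2 * n + 1))

section Geometry

variable {n : ℕ} {M : Type*} [TopologicalSpace M] [ChartedSpace (Model n) M]

/-- Smooth vector fields. -/
def IsSmoothField [IsManifold (𝓡 (2 * n + 1)) ∞ M] (X : ∀ x : M, TangentSpace (𝓡 (2 * n + 1)) x) : Prop :=
  ContMDiff (𝓡 (2 * n + 1)) (𝓡 (2 * n + 1)).tangent ∞
    (fun x => (⟨x, X x⟩ : TangentBundle (𝓡 (2 * n + 1)) M))

/-- The coordinate representation of a `1`-form in the preferred chart at `x₀`, that is, its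
pullback by the inverse of the chart. -/
def formRep (η : ∀ x : M, TangentSpace (𝓡 (2 * n + 1)) x →L[ℝ] ℝ) (x₀ : M) :
    Model n → (Model n →L[ℝ] ℝ) :=
  fun y => (η ((extChartAt (𝓡 (2 * n + 1)) x₀).symm y)).comp
    (mfderiv 𝓘(ℝ, Model n) (𝓡 (2 * n + 1)) (extChartAt (𝓡 (2 * n + 1)) x₀).symm y)

/-- The coordinate representation of a vector field in the preferred chart at `x₀`, that is, its
pushforward by the chart. -/
def fieldRep (X : ∀ x : M, TangentSpace (𝓡 (2 * n + 1)) x) (x₀ : M) : Model n → Model n :=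
  fun y => mfderiv (𝓡 (2 * n + 1)) 𝓘(ℝ, Model n) (extChartAt (𝓡 (2 * n + 1)) x₀)
    ((extChartAt (𝓡 (2 * n + 1)) x₀).symm y) (X ((extChartAt (𝓡 (2 * n + 1)) x₀).symm y))

/-- The coordinates of a tangent vector at `x` in the preferred chart at `x`. -/
def vecRep (x : M) (v : TangentSpace (𝓡 (2 * n + 1)) x) : Model n :=
  mfderiv (𝓡 (2 * n + 1)) 𝓘(ℝ, Model n) (extChartAt (𝓡 (2 * n + 1)) x) x v

/-- Smooth `1`-forms: the coordinate representations in the preferred charts at all points are smooth. -/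
def IsSmoothForm
    (η : ∀ x : M, TangentSpace (𝓡 (2 * n + 1)) x →L[ℝ] ℝ) : Prop :=
  ∀ x₀ : M, ContDiffOn ℝ ∞ (formRep η x₀) (extChartAt (𝓡 (2 * n + 1)) x₀).target

/-- The exterior derivative of a `1`-form, `dη(v, w) = ∑ᵢⱼ (∂ᵢ ηⱼ - ∂ⱼ ηᵢ) vⁱ wʲ`. -/
def extDer (η : ∀ x : M, TangentSpace (𝓡 (2 * n + 1)) x →L[ℝ] ℝ) (x : M)
    (v w : TangentSpace (𝓡 (2 * n + 1)) x) : ℝ :=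
  fderiv ℝ (formRep η x) (extChartAt (𝓡 (2 * n + 1)) x x) (vecRep x v) (vecRep x w) -
    fderiv ℝ (formRep η x) (extChartAt (𝓡 (2 * n + 1)) x x) (vecRep x w) (vecRep x v)

/-- The Lie derivative of a `1`-form,
`(£_X η)(v) = ∑ᵢⱼ (Xʲ ∂ⱼ ηᵢ + ηⱼ ∂ᵢ Xʲ) vⁱ`. -/
def lieDer (X : ∀ x : M, TangentSpace (𝓡 (2 * n + 1)) x)
    (η : ∀ x : M, TangentSpace (𝓡 (2 * n + 1)) x →L[ℝ] ℝ) (x : M)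
    (v : TangentSpace (𝓡 (2 * n + 1)) x) : ℝ :=
  fderiv ℝ (formRep η x) (extChartAt (𝓡 (2 * n + 1)) x x) (vecRep x (X x)) (vecRep x v) +
    formRep η x (extChartAt (𝓡 (2 * n + 1)) x x)
      (fderiv ℝ (fieldRep X x) (extChartAt (𝓡 (2 * n + 1)) x x) (vecRep x v))

/-- The value of `η ∧ (dη)ⁿ` on `2n+1` tangent vectors, up to a positive factor that depends
only on `n` and on the normalization of the wedge product. -/
def volumeForm (η : ∀ x : M, TangentSpace (𝓡 (2 * n + 1)) x →L[ℝ] ℝ) (x : M)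
    (v : Fin (2 * n + 1) → TangentSpace (𝓡 (2 * n + 1)) x) : ℝ :=
  ∑ σ : Equiv.Perm (Fin (2 * n + 1)), ((Equiv.Perm.sign σ : ℤ) : ℝ) * (η x (v (σ 0)) *
    ∏ i : Fin n, extDer η x (v (σ ⟨2 * i + 1, by omega⟩)) (v (σ ⟨2 * i + 2, by omega⟩)))

/-- `η` is a contact form: a smooth `1`-form with `η ∧ (dη)ⁿ ≠ 0` at every point. -/
structure IsContactForm
    (η : ∀ x : M, TangentSpace (𝓡 (2 * n + 1)) x →L[ℝ] ℝ) : Prop where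
  smooth : IsSmoothForm η
  nondegenerate : ∀ x : M, ∃ v : Fin (2 * n + 1) → TangentSpace (𝓡 (2 * n + 1)) x,
    volumeForm η x v ≠ 0

/-- `X` is the contact Hamiltonian vector field of `H`: `£_X η = ρ η` for some function `ρ`, and
`ι_X η = -H`. -/
structure IsContactHamiltonianField [IsManifold (𝓡 (2 * n + 1)) ∞ M]
    (η : ∀ x : M, TangentSpace (𝓡 (2 * n + 1)) x →L[ℝ] ℝ)
    (H : M → ℝ) (X : ∀ x : M, TangentSpace (𝓡 (2 * n + 1)) x) : Prop where
  smooth : IsSmoothField X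
  lieDer_eq : ∃ ρ : M → ℝ, ∀ (x : M) (v : TangentSpace (𝓡 (2 * n + 1)) x),
    lieDer X η x v = ρ x * η x v
  apply_eq : ∀ x : M, η x (X x) = -H x

/-- A smooth local flow `(t, x) ↦ exp(tY) x` of the vector field `Y`. The domain is all of `ℝ × M`
when `Y` is complete; the domain of the maximal flow is allowed as well. -/
structure LocalFlow (Y : ∀ x : M, TangentSpace (𝓡 (2 * n + 1)) x) where
  dom : Set (ℝ × M)
  toFun : ℝ → M → M
  isOpen_dom : IsOpen dom
  zero_mem : ∀ x, (0, x) ∈ dom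
  ordConnected : ∀ x, {t | (t, x) ∈ dom}.OrdConnected
  map_zero : ∀ x, toFun 0 x = x
  integralCurve : ∀ x, IsMIntegralCurveOn (fun t => toFun t x) Y {t | (t, x) ∈ dom}
  smooth : ContMDiffOn (𝓘(ℝ, ℝ).prod (𝓡 (2 * n + 1))) (𝓡 (2 * n + 1)) ∞
    (fun p : ℝ × M => toFun p.1 p.2) dom
  neg_mem : ∀ t x, (t, x) ∈ dom → (-t, toFun t x) ∈ dom
  neg_map : ∀ t x, (t, x) ∈ dom → toFun (-t) (toFun t x) = x

/-- The map `exp(tY)`, a homeomorphism between open subsets of `M`. -/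
def LocalFlow.exp {Y : ∀ x : M, TangentSpace (𝓡 (2 * n + 1)) x} (F : LocalFlow Y) (t : ℝ) :
    OpenPartialHomeomorph M M where
  toFun := F.toFun t
  invFun := F.toFun (-t)
  source := {x | (t, x) ∈ F.dom}
  target := {x | (-t, x) ∈ F.dom}
  map_source' := fun x hx => F.neg_mem t x hx
  map_target' := fun x hx => by simpa using F.neg_mem (-t) x hx
  left_inv' := fun x hx => F.neg_map t x hx
  right_inv' := fun x hx => by simpa using F.neg_map (-t) x hx
  open_source := F.isOpen_dom.preimage (by fun_prop)
  open_target := F.isOpen_dom.preimage (by fun_prop)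
  continuousOn_toFun := F.smooth.continuousOn.comp (f := fun x => (t, x))
    (by fun_prop) (fun _ hx => hx)
  continuousOn_invFun := F.smooth.continuousOn.comp (f := fun x => (-t, x))
    (by fun_prop) (fun _ hx => hx)

/-- `f` is a contactomorphism between its (open) source and target: a diffeomorphism with
`f^*η = ρ η` for a nowhere vanishing function `ρ`. -/
structure IsContactMap (η : ∀ x : M, TangentSpace (𝓡 (2 * n + 1)) x →L[ℝ] ℝ)
    (f : OpenPartialHomeomorph M M) : Prop where
  smooth : ContMDiffOn (𝓡 (2 * n + 1)) (𝓡 (2 * n + 1)) ∞ f f.source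
  smooth_symm : ContMDiffOn (𝓡 (2 * n + 1)) (𝓡 (2 * n + 1)) ∞ f.symm f.target
  pullback : ∃ ρ : M → ℝ, ∀ x ∈ f.source, ρ x ≠ 0 ∧
    ∀ v : TangentSpace (𝓡 (2 * n + 1)) x,
      η (f x) (mfderiv (𝓡 (2 * n + 1)) (𝓡 (2 * n + 1)) f x v) = ρ x * η x v

/-- `S` is an integrator of order `p` for `ẋ = X(x)`: locally uniformly in the initial value `x`,
the step `S(τ) x` is defined for small `τ` and differs, in a chart, from the exact solution
`Φ(τ, x)` by `O(τ^(p+1))`. -/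
def HasOrder (S : ℝ → OpenPartialHomeomorph M M)
    (X : ∀ x : M, TangentSpace (𝓡 (2 * n + 1)) x) (p : ℕ) : Prop :=
  ∀ x₀ : M, ∃ U ∈ 𝓝 x₀, ∃ δ > 0, ∃ C : ℝ, ∃ Φ : ℝ → M → M, ∀ x ∈ U,
    Φ 0 x = x ∧ IsMIntegralCurveOn (fun t => Φ t x) X (Set.Ioo (-δ) δ) ∧
    ∀ τ ∈ Set.Ioo (-δ) δ, x ∈ (S τ).source ∧
      S τ x ∈ (extChartAt (𝓡 (2 * n + 1)) x₀).source ∧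
      Φ τ x ∈ (extChartAt (𝓡 (2 * n + 1)) x₀).source ∧
      ‖extChartAt (𝓡 (2 * n + 1)) x₀ (S τ x) - extChartAt (𝓡 (2 * n + 1)) x₀ (Φ τ x)‖
        ≤ C * |τ| ^ (p + 1)

/-- A contact integrator of order `p`: an integrator of order `p` each of whose steps is a contact
transformation. -/
structure IsContactIntegrator (η : ∀ x : M, TangentSpace (𝓡 (2 * n + 1)) x →L[ℝ] ℝ)
    (X : ∀ x : M, TangentSpace (𝓡 (2 * n + 1)) x) (S : ℝ → OpenPartialHomeomorph M M) (p : ℕ) :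
    Prop where
  order : HasOrder S X p
  contact : ∀ τ : ℝ, IsContactMap η (S τ)

end Geometry

section Compositions

variable {M : Type*} [TopologicalSpace M]

/-- The splitting integrator
`S₂(τ) = e₁(τ/2) e₂(τ/2) ⋯ e_N(τ) ⋯ e₂(τ/2) e₁(τ/2)` built from the maps `e₁, …, e_N`. -/
def splitting : List (ℝ → OpenPartialHomeomorph M M) → ℝ → OpenPartialHomeomorph M M
  | [], _ => OpenPartialHomeomorph.refl M
  | [e], τ => e τ
  | e :: e' :: es, τ => (e (τ / 2)).trans ((splitting (e' :: es) τ).trans (e (τ / 2)))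

/-- `z₀(n) = - 2^(1/(2n+1)) / (2 - 2^(1/(2n+1)))`. -/
def z₀ (n : ℕ) : ℝ :=
  -((2 : ℝ) ^ (1 / (2 * (n : ℝ) + 1)) / (2 - (2 : ℝ) ^ (1 / (2 * (n : ℝ) + 1))))

/-- `z₁(n) = 1 / (2 - 2^(1/(2n+1)))`. -/
def z₁ (n : ℕ) : ℝ :=
  1 / (2 - (2 : ℝ) ^ (1 / (2 * (n : ℝ) + 1)))

/-- The triple-jump recursion `S_{2n+2}(τ) = S_{2n}(z₁(n) τ) S_{2n}(z₀(n) τ) S_{2n}(z₁(n) τ)`;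
`tripleJump S₂ k` is `S_{2k+2}`. -/
def tripleJump (S₂ : ℝ → OpenPartialHomeomorph M M) : ℕ → ℝ → OpenPartialHomeomorph M M
  | 0 => S₂
  | k + 1 => fun τ => (tripleJump S₂ k (z₁ (k + 1) * τ)).trans
      ((tripleJump S₂ k (z₀ (k + 1) * τ)).trans (tripleJump S₂ k (z₁ (k + 1) * τ)))

/-- The symmetric composition
`S⁽ᵐ⁾(τ) = S₂(w_m τ) S₂(w_{m-1} τ) ⋯ S₂(w₀ τ) ⋯ S₂(w_{m-1} τ) S₂(w_m τ)`. -/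
def symmetricComposition (S₂ : ℝ → OpenPartialHomeomorph M M) (w : ℕ → ℝ) :
    ℕ → ℝ → OpenPartialHomeomorph M M
  | 0 => fun τ => S₂ (w 0 * τ)
  | m + 1 => fun τ => (S₂ (w (m + 1) * τ)).trans
      ((symmetricComposition S₂ w m τ).trans (S₂ (w (m + 1) * τ)))

end Compositions

end ContactIntegrator

end

open ContactIntegrator

/-! Two properties of the splitting `S₂` carry the order claim: time symmetry, `S₂(-τ) = S₂(τ)⁻¹`,
because its word of flows is a palindrome, and consistency, meaning that its initial velocity is the
contact Hamiltonian field `X`. Since the initial velocity is the sum of the fields `Y j`,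
consistency is the identity `X = ∑ Y j` (`IsContactHamiltonianField.eq_sum`). The difference `Z` of
the two sides satisfies `η(Z) = 0`, and Cartan's formula makes `ι_Z dη` a multiple of `η`; such a
vector annihilates `η ∧ (dη)ⁿ`, so it is zero.

The order is read off in a chart by comparison with the flow `α` of `X`. A method of order `p` has
the form `α + τ^(p+1) c + O(τ^(p+2))` with `c` smooth (`HasOrderNear.exists_expansion`), and under
composition both the times and the coefficients `c` add (`HasExpansion.comp`). For odd `p`, symmetry
gives `2c = 0`, so the order is really `p + 1`. The triple jump replaces `c` by `(2 z₁^(p+1) +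
z₀^(p+1)) c = 0` and preserves symmetry. Hence each jump gains two orders, one by cancellation and
one by symmetry, starting from order `2`.

Each step is a contact map because the pullback of `η` along an exact flow satisfies a linear
equation `g' = ρ g`, which preserves the kernel of `η` (`LocalFlow.isContactMap_exp`), and contact
maps compose.

The symmetric composition needs no separate analysis: multiplying out the triple-jump recursion
gives a palindromic list of odd length and sum `1`, which is a universal choice of the `w j`. -/

namespace ContactIntegrator

/-! ### Local flows and estimates uniform in the initial value. -/

section LocalAnalysis

open Filter Asymptotics

variable {E : Type*} [NormedAddCommGroup E] [NormedSpace ℝ E]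

/-- Neighbourhoods of `(0, y₀)` contain products with a ball around `0`, hence whole time segments
through `0`; the mean value inequality is applied along these. -/
theorem eventually_forall_abs_le {Y : Type*} [TopologicalSpace Y] {y₀ : Y} {P : ℝ × Y → Prop}
    (h : ∀ᶠ q in 𝓝 ((0 : ℝ), y₀), P q) :
    ∀ᶠ q in 𝓝 ((0 : ℝ), y₀), ∀ u : ℝ, |u| ≤ |q.1| → P (u, q.2) := by
  rw [nhds_prod_eq] at h ⊢
  obtain ⟨A, hA, B, hB, hAB⟩ := eventually_prod_iff.1 h
  obtain ⟨ε, hε, hball⟩ := Metric.eventually_nhds_iff_ball.1 hA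
  refine eventually_prod_iff.2 ⟨fun t => t ∈ Metric.ball 0 ε, Metric.ball_mem_nhds _ hε, B, hB,
    fun {t} ht {y} hy u hu => hAB (hball u ?_) hy⟩
  simp only [Metric.mem_ball, dist_zero_right, Real.norm_eq_abs] at ht ⊢
  exact hu.trans_lt ht

theorem tendsto_scale {Y : Type*} [TopologicalSpace Y] (a : ℝ) (y₀ : Y) :
    Tendsto (fun q : ℝ × Y => (a * q.1, q.2)) (𝓝 (0, y₀)) (𝓝 (0, y₀)) := by
  have : Continuous fun q : ℝ × Y => (a * q.1, q.2) := by fun_prop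
  simpa using this.tendsto (0, y₀)

/-- Integration in time of a bound on the time derivative. -/
theorem isBigO_of_hasDerivAt {Y : Type*} [TopologicalSpace Y] {y₀ : Y} {g g' : ℝ × Y → E}
    {ψ : Y → ℝ} {m : ℕ} (h0 : ∀ᶠ y in 𝓝 y₀, g (0, y) = 0)
    (hd : ∀ᶠ q in 𝓝 ((0 : ℝ), y₀), HasDerivAt (fun t => g (t, q.2)) (g' q) q.1)
    (hg' : g' =O[𝓝 ((0 : ℝ), y₀)] fun q => q.1 ^ m * ψ q.2) :
    g =O[𝓝 ((0 : ℝ), y₀)] fun q => q.1 ^ (m + 1) * ψ q.2 := by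
  obtain ⟨C, hC⟩ := hg'.bound
  refine IsBigO.of_bound C ?_
  have h0' : ∀ᶠ q in 𝓝 ((0 : ℝ), y₀), g (0, q.2) = 0 := by
    rw [nhds_prod_eq]; exact h0.prod_inr _
  filter_upwards [eventually_forall_abs_le hd, eventually_forall_abs_le hC, h0'] with q hq hb hz
  -- The constant `C` carries no sign, and replacing `|u|` by `|q.1|` needs `0 ≤ C`. This follows
  -- from the bound itself unless `ψ q.2` or `q.1` vanishes, and those cases are immediate.
  have hC0 : ∀ u : ℝ, |u| ≤ |q.1| → ‖g' (u, q.2)‖ ≤ C * (|q.1| ^ m * ‖ψ q.2‖) := by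
    intro u hu
    by_cases hψ : ψ q.2 = 0
    · have := hb u hu
      simpa [hψ] using this
    by_cases hq1 : q.1 = 0
    · have hu0 : u = q.1 := by
        rw [hq1] at hu ⊢; simpa using hu
      have := hb q.1 le_rfl
      rw [hu0]
      simpa [norm_mul, norm_pow] using this
    have hCn : 0 ≤ C := by
      have := (norm_nonneg _).trans (hb q.1 le_rfl)
      refine nonneg_of_mul_nonneg_left this ?_
      simp only [norm_mul, norm_pow]
      positivity
    refine (hb u hu).trans ?_
    simp only [norm_mul, norm_pow, Real.norm_eq_abs]
    gcongr
  have key := (convex_uIcc (0 : ℝ) q.1).norm_image_sub_le_of_norm_hasDerivWithin_le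
    (f := fun t => g (t, q.2)) (f' := fun t => g' (t, q.2)) (C := C * (|q.1| ^ m * ‖ψ q.2‖))
    (fun u hu => (hq u ?_).hasDerivWithinAt) (fun u hu => hC0 u ?_)
    (Set.left_mem_uIcc) (Set.right_mem_uIcc)
  · simp only [hz, sub_zero] at key
    refine key.trans (le_of_eq ?_)
    simp only [norm_mul, norm_pow, Real.norm_eq_abs]
    ring
  all_goals
    rcases le_total 0 q.1 with h | h
    · rw [Set.uIcc_of_le h] at hu
      rw [abs_of_nonneg hu.1, abs_of_nonneg h]; exact hu.2
    · rw [Set.uIcc_of_ge h] at hu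
      rw [abs_of_nonpos hu.2, abs_of_nonpos h]; linarith [hu.1]

theorem isBigO_pow_of_hasDerivAt {Y : Type*} [TopologicalSpace Y] {y₀ : Y} {g g' : ℝ × Y → E}
    {m : ℕ} (h0 : ∀ᶠ y in 𝓝 y₀, g (0, y) = 0)
    (hd : ∀ᶠ q in 𝓝 ((0 : ℝ), y₀), HasDerivAt (fun t => g (t, q.2)) (g' q) q.1)
    (hg' : g' =O[𝓝 ((0 : ℝ), y₀)] fun q => q.1 ^ m) :
    g =O[𝓝 ((0 : ℝ), y₀)] fun q => q.1 ^ (m + 1) := by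
  simpa using isBigO_of_hasDerivAt (ψ := fun _ => 1) h0 hd (by simpa using hg')

/-- A coefficient of `τ ^ m` that is of higher order vanishes. -/
theorem eventually_eq_zero_of_isBigO {Y : Type*} [TopologicalSpace Y] {y₀ : Y} {c : Y → E} {m : ℕ}
    (h : (fun q : ℝ × Y => q.1 ^ m • c q.2) =O[𝓝 ((0 : ℝ), y₀)] fun q => q.1 ^ (m + 1)) :
    ∀ᶠ y in 𝓝 y₀, c y = 0 := by
  obtain ⟨C, hC⟩ := h.bound
  rw [nhds_prod_eq] at hC
  filter_upwards [(eventually_swap_iff.1 hC).curry] with y hy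
  have h1 : ∀ᶠ t : ℝ in 𝓝[≠] 0, ‖c y‖ ≤ C * |t| := by
    filter_upwards [hy.filter_mono nhdsWithin_le_nhds, self_mem_nhdsWithin] with t ht ht0
    simp only [Prod.swap, norm_smul, norm_pow, Real.norm_eq_abs, pow_succ, abs_mul, abs_pow] at ht
    have hpos : 0 < |t| ^ m := pow_pos (abs_pos.2 ht0) _
    have : |t| ^ m * ‖c y‖ ≤ |t| ^ m * (C * |t|) := ht.trans (le_of_eq (by ring))
    exact le_of_mul_le_mul_left this hpos
  have h2 : Tendsto (fun t : ℝ => C * |t|) (𝓝[≠] 0) (𝓝 0) := by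
    have : Continuous fun t : ℝ => C * |t| := by fun_prop
    simpa using (this.tendsto 0).mono_left nhdsWithin_le_nhds
  exact norm_le_zero_iff.1 (ge_of_tendsto h2 h1)

/-- `α` is, near `(0, y₀)`, the flow of the vector field `f`. -/
structure IsFlowNear (f : E → E) (α : ℝ × E → E) (y₀ : E) : Prop where
  eventually_zero : ∀ᶠ y in 𝓝 y₀, α (0, y) = y
  eventually_hasDerivAt : ∀ᶠ q in 𝓝 ((0 : ℝ), y₀),
    HasDerivAt (fun t => α (t, q.2)) (f (α q)) q.1
  continuousAt : ContinuousAt α (0, y₀)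
  lipschitz : (fun q : ℝ × E × E => α (q.1, q.2.1) - α (q.1, q.2.2)) =O[𝓝 (0, y₀, y₀)]
    fun q => ‖q.2.1 - q.2.2‖

/-- Picard–Lindelöf with one time interval for all initial values in a ball. Lipschitz dependence on
the initial value is all the spatial regularity of `α` that is used later. -/
theorem exists_isFlowNear [CompleteSpace E] {f : E → E} {y₀ : E} (hf : ContDiffAt ℝ 1 f y₀) :
    ∃ α, IsFlowNear f α y₀ := by
  obtain ⟨ε, hε, a, r, L, K, hr, hpl⟩ := IsPicardLindelof.of_contDiffAt_one hf
  obtain ⟨α, hα, L', hL'⟩ :=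
    (hpl 0).exists_forall_mem_closedBall_eq_hasDerivWithinAt_lipschitzOnWith
  have hr' : (0 : ℝ) < r := hr
  have hball : Metric.closedBall y₀ r ∈ 𝓝 y₀ := Metric.closedBall_mem_nhds _ hr'
  have hIoo : Set.Ioo (0 - ε) (0 + ε) ∈ 𝓝 (0 : ℝ) := Ioo_mem_nhds (by linarith) (by linarith)
  have hcont : ContinuousOn (Function.uncurry α)
      (Metric.closedBall y₀ r ×ˢ Set.Icc (0 - ε) (0 + ε)) :=
    continuousOn_prod_of_continuousOn_lipschitzOnWith _ L'
      (fun x hx => HasDerivWithinAt.continuousOn (hα x hx).2) hL'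
  refine ⟨fun q => α q.2 q.1, ?_, ?_, ?_, ?_⟩
  · filter_upwards [hball] with y hy using (hα y hy).1
  · filter_upwards [prod_mem_nhds hIoo hball] with q hq
    exact ((hα q.2 hq.2).2 q.1 (Set.Ioo_subset_Icc_self hq.1)).hasDerivAt
      (Icc_mem_nhds hq.1.1 hq.1.2)
  · have h1 : ContinuousAt (Function.uncurry α) (y₀, 0) :=
      hcont.continuousAt (prod_mem_nhds hball (Icc_mem_nhds (by linarith) (by linarith)))
    exact ContinuousAt.comp (f := Prod.swap) (g := Function.uncurry α) (x := ((0 : ℝ), y₀)) h1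
      continuous_swap.continuousAt
  · refine IsBigO.of_bound L' ?_
    filter_upwards [prod_mem_nhds hIoo (prod_mem_nhds hball hball)] with q hq
    have := (hL' q.1 (Set.Ioo_subset_Icc_self hq.1)).dist_le_mul _ hq.2.1 _ hq.2.2
    simpa [dist_eq_norm] using this

namespace IsFlowNear

variable {f : E → E} {α : ℝ × E → E} {y₀ : E}

theorem apply_zero (h : IsFlowNear f α y₀) : α (0, y₀) = y₀ := h.eventually_zero.self_of_nhds

theorem tendsto (h : IsFlowNear f α y₀) : Tendsto α (𝓝 (0, y₀)) (𝓝 y₀) := by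
  simpa [ContinuousAt, h.apply_zero] using h.continuousAt

/-- The Lipschitz bound on `f` is integrated in time, with `‖y - y'‖` as the weight `ψ`. Thus the
flow transports an error unchanged up to a factor `1 + O(τ)`. -/
theorem sub_sub_isBigO (h : IsFlowNear f α y₀) (hf : ContDiffAt ℝ 1 f y₀) :
    (fun q : ℝ × E × E => α (q.1, q.2.1) - α (q.1, q.2.2) - (q.2.1 - q.2.2))
      =O[𝓝 (0, y₀, y₀)] fun q => q.1 * ‖q.2.1 - q.2.2‖ := by
  obtain ⟨K, s, hs, hK⟩ := hf.exists_lipschitzOnWith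
  have t1 : Tendsto (fun q : ℝ × E × E => (q.1, q.2.1)) (𝓝 (0, y₀, y₀)) (𝓝 (0, y₀)) :=
    (by fun_prop : Continuous fun q : ℝ × E × E => (q.1, q.2.1)).tendsto' _ _ rfl
  have t2 : Tendsto (fun q : ℝ × E × E => (q.1, q.2.2)) (𝓝 (0, y₀, y₀)) (𝓝 (0, y₀)) :=
    (by fun_prop : Continuous fun q : ℝ × E × E => (q.1, q.2.2)).tendsto' _ _ rfl
  have := isBigO_of_hasDerivAt (m := 0) (ψ := fun p : E × E => ‖p.1 - p.2‖) (y₀ := (y₀, y₀))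
    (g := fun q : ℝ × E × E => α (q.1, q.2.1) - α (q.1, q.2.2) - (q.2.1 - q.2.2))
    (g' := fun q => f (α (q.1, q.2.1)) - f (α (q.1, q.2.2))) ?_ ?_ ?_
  · simpa using this
  · filter_upwards [(continuous_fst.tendsto' (y₀, y₀) y₀ rfl).eventually h.eventually_zero,
      (continuous_snd.tendsto' (y₀, y₀) y₀ rfl).eventually h.eventually_zero] with p h1 h2
    simp [h1, h2]
  · filter_upwards [t1.eventually h.eventually_hasDerivAt,
      t2.eventually h.eventually_hasDerivAt] with q h1 h2
    exact (h1.sub h2).sub_const _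
  · simp only [pow_zero, one_mul]
    refine IsBigO.trans (IsBigO.of_bound K ?_) h.lipschitz
    filter_upwards [(h.tendsto.comp t1).eventually hs, (h.tendsto.comp t2).eventually hs]
      with q h1 h2
    simpa [dist_eq_norm] using hK.dist_le_mul _ h1 _ h2

theorem comp_isBigO (h : IsFlowNear f α y₀) (hf : ContinuousAt f y₀) :
    (fun q => f (α q)) =O[𝓝 (0, y₀)] fun _ => (1 : ℝ) :=
  (hf.tendsto.comp h.tendsto).isBigO_one ℝ

theorem sub_id_isBigO (h : IsFlowNear f α y₀) (hf : ContinuousAt f y₀) :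
    (fun q : ℝ × E => α q - q.2) =O[𝓝 (0, y₀)] fun q => q.1 := by
  have := isBigO_pow_of_hasDerivAt (m := 0) (y₀ := y₀) (g := fun q : ℝ × E => α q - q.2)
    (g' := fun q => f (α q)) ?_ ?_ ?_
  · simpa using this
  · filter_upwards [h.eventually_zero] with y hy
    simp [hy]
  · filter_upwards [h.eventually_hasDerivAt] with q hq using hq.sub_const _
  · simpa using h.comp_isBigO hf

/-- The local group law. -/
theorem eventually_add (h : IsFlowNear f α y₀) (hf : ContDiffAt ℝ 1 f y₀) (a b : ℝ) :
    ∀ᶠ q in 𝓝 ((0 : ℝ), y₀), α (a * q.1, α (b * q.1, q.2)) = α ((a + b) * q.1, q.2) := by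
  obtain ⟨K, s, hs, hK⟩ := hf.exists_lipschitzOnWith
  have good : ∀ᶠ q in 𝓝 ((0 : ℝ), y₀), HasDerivAt (fun t => α (t, q.2)) (f (α q)) q.1 ∧ α q ∈ s :=
    h.eventually_hasDerivAt.and (h.tendsto.eventually hs)
  have t1 : Tendsto (fun q : ℝ × E => ((|a| + |b| + 1) * q.1, q.2)) (𝓝 (0, y₀)) (𝓝 (0, y₀)) :=
    tendsto_scale _ _
  have t2 : Tendsto (fun q : ℝ × E => ((|a| + |b| + 1) * q.1, α (b * q.1, q.2)))
      (𝓝 (0, y₀)) (𝓝 (0, y₀)) := by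
    rw [nhds_prod_eq (x := (0 : ℝ)) (y := y₀)]
    refine Tendsto.prodMk ?_ (by rw [← nhds_prod_eq]; exact h.tendsto.comp (tendsto_scale b y₀))
    rw [← nhds_prod_eq]
    exact (by fun_prop : Continuous fun q : ℝ × E => (|a| + |b| + 1) * q.1).tendsto' _ _ (by simp)
  have t3 : Tendsto (fun q : ℝ × E => α (b * q.1, q.2)) (𝓝 (0, y₀)) (𝓝 y₀) :=
    h.tendsto.comp (tendsto_scale b y₀)
  filter_upwards [t1.eventually (eventually_forall_abs_le good),
    t2.eventually (eventually_forall_abs_le good), t3.eventually h.eventually_zero]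
    with q h1 h2 h3
  by_cases hq : q.1 = 0
  · simp only [hq, mul_zero] at h3 ⊢
    exact h3
  have hq' : 0 < |q.1| := abs_pos.2 hq
  -- The margin `1/2` puts `a * q.1` strictly inside `(-δ, δ)`, while times up to `δ + |b * q.1|`
  -- stay below `(|a| + |b| + 1) * |q.1|`, where both curves are known to solve the equation inside
  -- `s`.
  set δ : ℝ := (|a| + 1 / 2) * |q.1| with hδ
  have hδ0 : 0 < δ := by positivity
  have hb : |b * q.1| = |b| * |q.1| := abs_mul _ _
  have ha : |a * q.1| = |a| * |q.1| := abs_mul _ _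
  have hM : |(|a| + |b| + 1) * q.1| = (|a| + |b| + 1) * |q.1| := by
    rw [abs_mul, abs_of_nonneg (by positivity)]
  have hbn := mul_nonneg (abs_nonneg b) hq'.le
  have key := ODE_solution_unique_of_mem_Ioo (v := fun _ => f) (s := fun _ => s) (K := K)
    (a := -δ) (b := δ) (t₀ := 0) (f := fun t => α (t, α (b * q.1, q.2)))
    (g := fun t => α (t + b * q.1, q.2)) (fun _ _ => hK) ⟨by linarith, hδ0⟩ ?_ ?_
    (by simpa using h3)
  · have := key (show a * q.1 ∈ Set.Ioo (-δ) δ from abs_lt.1 (by rw [ha, hδ]; nlinarith))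
    simpa [add_mul] using this
  · intro t ht
    have ht' : |t| < δ := abs_lt.2 ht
    exact h2 t (by simp only [hM]; rw [hδ] at ht'; nlinarith)
  · intro t ht
    have ht' : |t| < δ := abs_lt.2 ht
    have := h1 (t + b * q.1) (by
      simp only [hM]; rw [hδ] at ht'
      refine (abs_add_le _ _).trans ?_
      rw [hb]; nlinarith)
    exact ⟨HasDerivAt.comp_add_const (f := fun u => α (u, q.2)) t (b * q.1) this.1, this.2⟩

end IsFlowNear

end LocalAnalysis

/-! ### Expansions in the step size with smooth coefficients. -/

section Expansions

open Filter Asymptotics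

variable {E : Type*} [NormedAddCommGroup E] [NormedSpace ℝ E]

/-- `g (τ, y)` is a smooth function of `τ`, `α (τ, y)` and `y` near `(0, y₀)`. -/
def IsSmoothAlong (α : ℝ × E → E) (y₀ : E) (g : ℝ × E → E) : Prop :=
  ∃ G : ℝ × E × E → E, ContDiffAt ℝ ∞ G (0, y₀, y₀) ∧
    g =ᶠ[𝓝 (0, y₀)] fun q => G (q.1, α q, q.2)

namespace IsSmoothAlong

variable {f : E → E} {α g : ℝ × E → E} {y₀ : E}

theorem tendsto_graph (hα : IsFlowNear f α y₀) :
    Tendsto (fun q : ℝ × E => (q.1, α q, q.2)) (𝓝 (0, y₀)) (𝓝 (0, y₀, y₀)) :=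
  (continuous_fst.tendsto' ((0 : ℝ), y₀) 0 rfl).prodMk_nhds
    (hα.tendsto.prodMk_nhds (continuous_snd.tendsto' ((0 : ℝ), y₀) y₀ rfl))

theorem exists_zero (hα : IsFlowNear f α y₀) (hg : IsSmoothAlong α y₀ g) :
    ∃ c : E → E, ContDiffAt ℝ ∞ c y₀ ∧ ∀ᶠ y in 𝓝 y₀, g (0, y) = c y := by
  obtain ⟨G, hG, hgG⟩ := hg
  refine ⟨fun y => G (0, y, y), hG.comp (f := fun y : E => ((0 : ℝ), y, y)) y₀ (by fun_prop), ?_⟩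
  have : Tendsto (fun y : E => ((0 : ℝ), y)) (𝓝 y₀) (𝓝 (0, y₀)) :=
    (by fun_prop : Continuous fun y : E => ((0 : ℝ), y)).tendsto' _ _ rfl
  filter_upwards [this.eventually hgG, hα.eventually_zero] with y h1 h2
  rw [h1, h2]

theorem isBigO_one (hα : IsFlowNear f α y₀) (hg : IsSmoothAlong α y₀ g) :
    g =O[𝓝 (0, y₀)] fun _ => (1 : ℝ) := by
  obtain ⟨G, hG, hgG⟩ := hg
  exact ((hG.continuousAt.tendsto.comp (tendsto_graph hα)).congr' hgG.symm).isBigO_one ℝ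

/-- By the chain rule, the time derivative of `G (τ, α, y)` is `DG (1, f α, 0)`, again of the same
form. This closure yields coefficients smooth in `y` although `α` is only known to be Lipschitz
there. -/
theorem exists_deriv (hf : ContDiffAt ℝ ∞ f y₀) (hα : IsFlowNear f α y₀)
    (hg : IsSmoothAlong α y₀ g) :
    ∃ g', IsSmoothAlong α y₀ g' ∧
      ∀ᶠ q in 𝓝 ((0 : ℝ), y₀), HasDerivAt (fun t => g (t, q.2)) (g' q) q.1 := by
  obtain ⟨G, hG, hgG⟩ := hg
  refine ⟨_, ⟨fun p => fderiv ℝ G p (1, f p.2.1, 0), ?_, EventuallyEq.rfl⟩, ?_⟩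
  · have h1 : ContDiffAt ℝ ∞ (fderiv ℝ G) (0, y₀, y₀) := hG.fderiv_right le_rfl
    have h2 : ContDiffAt ℝ ∞ (fun p : ℝ × E × E => f p.2.1) (0, y₀, y₀) :=
      hf.comp (f := fun p : ℝ × E × E => p.2.1) (0, y₀, y₀) (by fun_prop)
    exact h1.clm_apply (contDiffAt_const.prodMk (h2.prodMk contDiffAt_const))
  · have hd : ∀ᶠ p in 𝓝 ((0 : ℝ), y₀, y₀), DifferentiableAt ℝ G p := by
      filter_upwards [(hG.of_le (show (1 : ℕ∞ω) ≤ ∞ by exact_mod_cast le_top)).eventually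
        (by simp)] with p hp using hp.differentiableAt one_ne_zero
    filter_upwards [(tendsto_graph hα).eventually hd, hα.eventually_hasDerivAt,
      eventually_eventually_nhds.2 hgG] with q h1 h2 h3
    have h4 : HasDerivAt (fun t => G (t, α (t, q.2), q.2))
        (fderiv ℝ G (q.1, α q, q.2) (1, f (α q), 0)) q.1 :=
      HasFDerivAt.comp_hasDerivAt (f := fun t => (t, α (t, q.2), q.2)) q.1 h1.hasFDerivAt
        ((hasDerivAt_id q.1).prodMk (h2.prodMk (hasDerivAt_const _ _)))
    refine h4.congr_of_eventuallyEq ?_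
    have : Tendsto (fun t : ℝ => (t, q.2)) (𝓝 q.1) (𝓝 q) :=
      (by fun_prop : Continuous fun t : ℝ => (t, q.2)).tendsto' _ _ rfl
    exact this.eventually h3

/-- The two claims are proved by a joint induction. If `g = O(τ^(m+1))`, the second claim gives `g'
= O(τ^m)`, the first gives the leading coefficient `c` of `g'`, and integration gives `c / (m + 1)`
for `g`. If moreover `g = O(τ^(m+2))`, then `c` vanishes, which improves the bound on `g'`. -/
theorem exists_leading_and_deriv_isBigO (hf : ContDiffAt ℝ ∞ f y₀) (hα : IsFlowNear f α y₀)
    (m : ℕ) : ∀ g, IsSmoothAlong α y₀ g →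
      (g =O[𝓝 (0, y₀)] (fun q => q.1 ^ m) → ∃ c : E → E, ContDiffAt ℝ ∞ c y₀ ∧
        (fun q => g q - q.1 ^ m • c q.2) =O[𝓝 (0, y₀)] fun q => q.1 ^ (m + 1)) ∧
      ∀ g', IsSmoothAlong α y₀ g' →
        (∀ᶠ q in 𝓝 ((0 : ℝ), y₀), HasDerivAt (fun t => g (t, q.2)) (g' q) q.1) →
        g =O[𝓝 (0, y₀)] (fun q => q.1 ^ (m + 1)) → g' =O[𝓝 (0, y₀)] fun q => q.1 ^ m := by
  have vanish : ∀ (m : ℕ) (g : ℝ × E → E), g =O[𝓝 (0, y₀)] (fun q => q.1 ^ (m + 1)) →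
      ∀ᶠ y in 𝓝 y₀, g (0, y) = 0 := by
    intro m g hg
    have : Tendsto (fun y : E => ((0 : ℝ), y)) (𝓝 y₀) (𝓝 (0, y₀)) :=
      (by fun_prop : Continuous fun y : E => ((0 : ℝ), y)).tendsto' _ _ rfl
    obtain ⟨C, hC⟩ := hg.bound
    filter_upwards [this.eventually hC] with y hy
    simpa using hy
  have integrate : ∀ (m : ℕ) (g g' : ℝ × E → E) (c : E → E),
      (∀ᶠ q in 𝓝 ((0 : ℝ), y₀), HasDerivAt (fun t => g (t, q.2)) (g' q) q.1) →
      (∀ᶠ y in 𝓝 y₀, g (0, y) = 0) →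
      ((fun q => g' q - q.1 ^ m • c q.2) =O[𝓝 (0, y₀)] fun q => q.1 ^ (m + 1)) →
      (fun q => g q - q.1 ^ (m + 1) • ((m + 1 : ℝ)⁻¹ • c q.2))
        =O[𝓝 (0, y₀)] fun q => q.1 ^ (m + 2) := by
    intro m g g' c hd h0 hO
    refine isBigO_pow_of_hasDerivAt (g := fun q => g q - q.1 ^ (m + 1) • ((m + 1 : ℝ)⁻¹ • c q.2))
      ?_ ?_ hO
    · filter_upwards [h0] with y hy
      simp [hy]
    · filter_upwards [hd] with q hq
      have h1 := ((hasDerivAt_pow (m + 1) q.1).smul_const ((m + 1 : ℝ)⁻¹ • c q.2))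
      have h2 : (((m + 1 : ℕ) : ℝ) * q.1 ^ (m + 1 - 1)) • ((m + 1 : ℝ)⁻¹ • c q.2)
          = q.1 ^ m • c q.2 := by
        rw [smul_smul]; congr 1
        push_cast
        field_simp
      rw [h2] at h1
      exact hq.sub h1
  induction m with
  | zero =>
    intro g hg
    obtain ⟨g₁, hg₁, hd₁⟩ := exists_deriv hf hα hg
    refine ⟨fun _ => ?_, fun g' hg' _ _ => by simpa using hg'.isBigO_one hα⟩
    obtain ⟨c, hc, hgc⟩ := exists_zero hα hg
    refine ⟨c, hc, ?_⟩
    refine isBigO_pow_of_hasDerivAt (m := 0) (g := fun q => g q - q.1 ^ 0 • c q.2) (g' := g₁)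
      ?_ ?_ ?_
    · filter_upwards [hgc] with y hy
      simp [hy]
    · filter_upwards [hd₁] with q hq
      simpa using hq.sub_const (c q.2)
    · simpa using hg₁.isBigO_one hα
  | succ m ih =>
    intro g hg
    have step : ∀ g', IsSmoothAlong α y₀ g' →
        (∀ᶠ q in 𝓝 ((0 : ℝ), y₀), HasDerivAt (fun t => g (t, q.2)) (g' q) q.1) →
        g =O[𝓝 (0, y₀)] (fun q => q.1 ^ (m + 1)) → ∃ c : E → E, ContDiffAt ℝ ∞ c y₀ ∧
          ((fun q => g' q - q.1 ^ m • c q.2) =O[𝓝 (0, y₀)] fun q => q.1 ^ (m + 1)) ∧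
          (fun q => g q - q.1 ^ (m + 1) • ((m + 1 : ℝ)⁻¹ • c q.2))
            =O[𝓝 (0, y₀)] fun q => q.1 ^ (m + 2) := by
      intro g' hg' hd hO
      obtain ⟨c, hc, hcO⟩ := (ih g' hg').1 ((ih g hg).2 g' hg' hd hO)
      exact ⟨c, hc, hcO, integrate m g g' c hd (vanish m g hO) hcO⟩
    constructor
    · intro hO
      obtain ⟨g₁, hg₁, hd₁⟩ := exists_deriv hf hα hg
      obtain ⟨c, hc, -, hcO⟩ := step g₁ hg₁ hd₁ hO
      exact ⟨_, contDiffAt_const.smul hc, hcO⟩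
    · intro g' hg' hd hO
      have hO' : g =O[𝓝 (0, y₀)] (fun q => q.1 ^ (m + 1)) := by
        refine hO.trans ?_
        have : (fun q : ℝ × E => q.1) =O[𝓝 (0, y₀)] fun _ => (1 : ℝ) :=
          (continuous_fst.tendsto ((0 : ℝ), y₀)).isBigO_one ℝ
        simpa [pow_succ] using (isBigO_refl (fun q : ℝ × E => q.1 ^ (m + 1)) _).mul this
      obtain ⟨c, hc, hcO, hgO⟩ := step g' hg' hd hO'
      have h1 : (fun q : ℝ × E => q.1 ^ (m + 1) • ((m + 1 : ℝ)⁻¹ • c q.2))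
          =O[𝓝 (0, y₀)] fun q => q.1 ^ (m + 2) := by
        simpa using hO.sub hgO
      have h2 := eventually_eq_zero_of_isBigO (c := fun y => (m + 1 : ℝ)⁻¹ • c y) h1
      refine hcO.congr' ?_ EventuallyEq.rfl
      filter_upwards [(continuous_snd.tendsto' ((0 : ℝ), y₀) y₀ rfl).eventually h2] with q hq
      have : c q.2 = 0 := by
        have hm : (m + 1 : ℝ)⁻¹ ≠ 0 := by positivity
        exact (smul_eq_zero.1 hq).resolve_left hm
      simp [this]

theorem exists_leading (hf : ContDiffAt ℝ ∞ f y₀) (hα : IsFlowNear f α y₀)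
    (hg : IsSmoothAlong α y₀ g) {m : ℕ} (hO : g =O[𝓝 (0, y₀)] (fun q => q.1 ^ m)) :
    ∃ c : E → E, ContDiffAt ℝ ∞ c y₀ ∧
      (fun q => g q - q.1 ^ m • c q.2) =O[𝓝 (0, y₀)] fun q => q.1 ^ (m + 1) :=
  (exists_leading_and_deriv_isBigO hf hα m g hg).1 hO

end IsSmoothAlong

/-- `s (τ, y) = α (a τ, y) + τ ^ (m + 1) c (y) + O (τ ^ (m + 2))`. -/
def HasExpansion (α : ℝ × E → E) (y₀ : E) (m : ℕ) (s : ℝ × E → E) (a : ℝ) (c : E → E) : Prop :=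
  (fun q => s q - α (a * q.1, q.2) - q.1 ^ (m + 1) • c q.2) =O[𝓝 (0, y₀)] fun q => q.1 ^ (m + 2)

namespace HasExpansion

variable {f : E → E} {α s t : ℝ × E → E} {y₀ : E} {m : ℕ} {a b : ℝ} {c d : E → E}

theorem pow_isBigO {Y : Type*} [TopologicalSpace Y] (y₀ : Y) {i j : ℕ} (h : i ≤ j) :
    (fun q : ℝ × Y => q.1 ^ j) =O[𝓝 (0, y₀)] fun q => q.1 ^ i := by
  have : (fun q : ℝ × Y => q.1) =O[𝓝 (0, y₀)] fun _ => (1 : ℝ) :=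
    (continuous_fst.tendsto ((0 : ℝ), y₀)).isBigO_one ℝ
  obtain ⟨l, rfl⟩ := Nat.exists_eq_add_of_le h
  simpa [pow_add] using (isBigO_refl (fun q : ℝ × Y => q.1 ^ i) _).mul (this.pow l)

theorem scale (h : HasExpansion α y₀ m s a c) (r : ℝ) :
    HasExpansion α y₀ m (fun q => s (r * q.1, q.2)) (a * r) (fun y => r ^ (m + 1) • c y) := by
  have h1 := h.comp_tendsto (tendsto_scale r y₀)
  refine (h1.congr_left ?_).trans ?_
  · intro q
    simp only [Function.comp, mul_pow, smul_smul, mul_assoc]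
    rw [mul_comm (r ^ _)]
  · simp only [Function.comp_def, mul_pow]
    exact isBigO_const_mul_self _ _ _

theorem sub_flow_isBigO (h : HasExpansion α y₀ m s a c) (hc : ContinuousAt c y₀) :
    (fun q => s q - α (a * q.1, q.2)) =O[𝓝 (0, y₀)] fun q => q.1 ^ (m + 1) := by
  have h1 : (fun q : ℝ × E => q.1 ^ (m + 1) • c q.2) =O[𝓝 (0, y₀)] fun q => q.1 ^ (m + 1) := by
    have : (fun q : ℝ × E => c q.2) =O[𝓝 (0, y₀)] fun _ => (1 : ℝ) :=
      (hc.tendsto.comp (continuous_snd.tendsto' ((0 : ℝ), y₀) y₀ rfl)).isBigO_one ℝ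
    simpa using (isBigO_refl (fun q : ℝ × E => q.1 ^ (m + 1)) _).smul this
  simpa using (h.trans (pow_isBigO y₀ (by omega))).add h1

/-- Modulo `O(τ^(m+2))`, `t` may be replaced by its expansion at `s` (`e1`), the flow carries the
error of `s` unchanged (`e2`), and `d` may be evaluated at `y` instead of `s (τ, y)` (`e3`). The
group law then merges the two flows. -/
theorem comp (hf : ContDiffAt ℝ ∞ f y₀) (hα : IsFlowNear f α y₀)
    (hs : HasExpansion α y₀ m s a c) (ht : HasExpansion α y₀ m t b d)
    (hs0 : Tendsto s (𝓝 (0, y₀)) (𝓝 y₀))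
    (hc : ContDiffAt ℝ ∞ c y₀) (hd : ContDiffAt ℝ ∞ d y₀) :
    HasExpansion α y₀ m (fun q => t (q.1, s q)) (b + a) (fun y => c y + d y) := by
  have hf1 : ContDiffAt ℝ 1 f y₀ := hf.of_le (by exact_mod_cast le_top)
  have hfst : Tendsto (fun q : ℝ × E => q.1) (𝓝 (0, y₀)) (𝓝 0) :=
    continuous_fst.tendsto' ((0 : ℝ), y₀) 0 rfl
  have hα' : Tendsto (fun q : ℝ × E => α (a * q.1, q.2)) (𝓝 (0, y₀)) (𝓝 y₀) :=
    hα.tendsto.comp (tendsto_scale a y₀)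
  have hsα := hs.sub_flow_isBigO hc.continuousAt
  have e1 : (fun q => t (q.1, s q) - α (b * q.1, s q) - q.1 ^ (m + 1) • d (s q))
      =O[𝓝 (0, y₀)] fun q => q.1 ^ (m + 2) :=
    ht.comp_tendsto (hfst.prodMk_nhds hs0)
  have e2 : (fun q => α (b * q.1, s q) - α (b * q.1, α (a * q.1, q.2))
      - (s q - α (a * q.1, q.2))) =O[𝓝 (0, y₀)] fun q => q.1 ^ (m + 2) := by
    have hb : Tendsto (fun q : ℝ × E => b * q.1) (𝓝 (0, y₀)) (𝓝 0) := by
      simpa using hfst.const_mul b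
    have := (hα.sub_sub_isBigO hf1).comp_tendsto (hb.prodMk_nhds (hs0.prodMk_nhds hα'))
    refine this.trans ?_
    simp only [Function.comp_def]
    have h3 : (fun q : ℝ × E => b * q.1) =O[𝓝 (0, y₀)] fun q => q.1 := isBigO_const_mul_self _ _ _
    refine (h3.mul hsα.norm_left).congr_right fun q => ?_
    ring
  have e3 : (fun q => q.1 ^ (m + 1) • d (s q) - q.1 ^ (m + 1) • d q.2)
      =O[𝓝 (0, y₀)] fun q => q.1 ^ (m + 2) := by
    obtain ⟨K, u, hu, hK⟩ := 
      (hd.of_le (show (1 : ℕ∞ω) ≤ ∞ by exact_mod_cast le_top)).exists_lipschitzOnWith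
    have h4 : (fun q => d (s q) - d q.2) =O[𝓝 (0, y₀)] fun q => s q - q.2 := by
      refine IsBigO.of_bound K ?_
      filter_upwards [hs0.eventually hu,
        (continuous_snd.tendsto' ((0 : ℝ), y₀) y₀ rfl).eventually hu] with q h1 h2
      simpa [dist_eq_norm] using hK.dist_le_mul _ h1 _ h2
    have h5 : (fun q => s q - q.2) =O[𝓝 (0, y₀)] fun q : ℝ × E => q.1 := by
      have h6 := (hα.sub_id_isBigO hf.continuousAt).comp_tendsto (tendsto_scale a y₀)
      have h7 := h6.trans (isBigO_const_mul_self a (fun q : ℝ × E => q.1) _)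
      have h8 := hsα.trans (pow_isBigO y₀ (show 1 ≤ m + 1 by omega))
      simp only [pow_one] at h8
      refine (h8.add h7).congr_left fun q => ?_
      simp only [Function.comp]
      abel
    have h9 := (isBigO_refl (fun q : ℝ × E => q.1 ^ (m + 1)) (𝓝 (0, y₀))).smul (h4.trans h5)
    refine h9.congr (fun q => smul_sub _ _ _) fun q => ?_
    simp only [smul_eq_mul]; ring
  refine ((((e1.add e2).add e3).add hs).congr' ?_ EventuallyEq.rfl)
  filter_upwards [hα.eventually_add hf1 b a] with q hq
  rw [← hq, smul_add]
  abel

theorem unique (h : HasExpansion α y₀ m s a c) (h' : HasExpansion α y₀ m s a d) :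
    c =ᶠ[𝓝 y₀] d := by
  have h1 := h'.sub h
  have h2 : (fun q : ℝ × E => q.1 ^ (m + 1) • (c q.2 - d q.2))
      =O[𝓝 (0, y₀)] fun q => q.1 ^ (m + 2) := by
    refine h1.congr_left fun q => ?_
    rw [smul_sub]; abel
  filter_upwards [eventually_eq_zero_of_isBigO (c := fun y => c y - d y) h2] with y hy
  exact sub_eq_zero.1 hy

theorem congr_coeff (h : HasExpansion α y₀ m s a c) (hcd : c =ᶠ[𝓝 y₀] d) :
    HasExpansion α y₀ m s a d := by
  refine IsBigO.congr' h ?_ EventuallyEq.rfl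
  filter_upwards [(continuous_snd.tendsto' ((0 : ℝ), y₀) y₀ rfl).eventually hcd] with q hq
  rw [hq]

theorem congr (h : HasExpansion α y₀ m s a c) (hst : s =ᶠ[𝓝 (0, y₀)] t) :
    HasExpansion α y₀ m t a c := by
  refine IsBigO.congr' h ?_ EventuallyEq.rfl
  filter_upwards [hst] with q hq
  rw [hq]

end HasExpansion

/-- `s (τ, y) = α (τ, y) + O (τ ^ (p + 1))` near `(0, y₀)`. -/
def HasOrderNear (α : ℝ × E → E) (y₀ : E) (p : ℕ) (s : ℝ × E → E) : Prop :=
  (fun q => s q - α q) =O[𝓝 (0, y₀)] fun q => q.1 ^ (p + 1)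

/-- A smooth one-parameter family of local maps that is the identity at time `0`. -/
structure IsSmoothFamilyNear (y₀ : E) (s : ℝ × E → E) : Prop where
  contDiffAt : ContDiffAt ℝ ∞ s (0, y₀)
  eventually_zero : ∀ᶠ y in 𝓝 y₀, s (0, y) = y

/-- Time symmetry, `s (-τ) ∘ s (τ) = id`. -/
def IsSymmetricNear (y₀ : E) (s : ℝ × E → E) : Prop :=
  ∀ᶠ q in 𝓝 ((0 : ℝ), y₀), s (-q.1, s q) = q.2

/-- The triple jump with coefficients `z`, `w`, `z`. -/
def jump (z w : ℝ) (s : ℝ × E → E) (q : ℝ × E) : E :=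
  s (z * q.1, s (w * q.1, s (z * q.1, q.2)))

namespace IsSmoothFamilyNear

variable {s t : ℝ × E → E} {y₀ : E}

theorem tendsto (h : IsSmoothFamilyNear y₀ s) : Tendsto s (𝓝 (0, y₀)) (𝓝 y₀) := by
  have := h.contDiffAt.continuousAt
  rwa [ContinuousAt, h.eventually_zero.self_of_nhds] at this

theorem scale (h : IsSmoothFamilyNear y₀ s) (r : ℝ) :
    IsSmoothFamilyNear y₀ fun q => s (r * q.1, q.2) := by
  refine ⟨?_, by simpa using h.eventually_zero⟩
  refine ContDiffAt.comp (f := fun q : ℝ × E => (r * q.1, q.2)) _ ?_ (by fun_prop)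
  simpa using h.contDiffAt

theorem comp (hs : IsSmoothFamilyNear y₀ s) (ht : IsSmoothFamilyNear y₀ t) :
    IsSmoothFamilyNear y₀ fun q => t (q.1, s q) := by
  constructor
  · refine ContDiffAt.comp (f := fun q : ℝ × E => (q.1, s q)) _ ?_
      (contDiffAt_fst.prodMk hs.contDiffAt)
    simpa [hs.eventually_zero.self_of_nhds] using ht.contDiffAt
  · filter_upwards [hs.eventually_zero, ht.eventually_zero] with y h1 h2
    rw [h1, h2]

theorem jump (hs : IsSmoothFamilyNear y₀ s) (z w : ℝ) : IsSmoothFamilyNear y₀ (jump z w s) :=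
  ((hs.scale z).comp (hs.scale w)).comp (hs.scale z)

end IsSmoothFamilyNear

/-! ### Raising the order by symmetry and by the triple jump. -/

section Order

variable {f : E → E} {α s : ℝ × E → E} {y₀ : E} {p : ℕ}

/-- The error `s - α` is smooth along `α`, with `G (τ, x, y) = s (τ, y) - x`, so its leading
coefficient is smooth. -/
theorem HasOrderNear.exists_expansion (hf : ContDiffAt ℝ ∞ f y₀) (hα : IsFlowNear f α y₀)
    (hs : IsSmoothFamilyNear y₀ s) (h : HasOrderNear α y₀ p s) :
    ∃ c : E → E, ContDiffAt ℝ ∞ c y₀ ∧ HasExpansion α y₀ p s 1 c := by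
  have : IsSmoothAlong α y₀ fun q => s q - α q := by
    refine ⟨fun r => s (r.1, r.2.2) - r.2.1, ?_, EventuallyEq.rfl⟩
    refine ContDiffAt.sub ?_ (by fun_prop)
    exact ContDiffAt.comp (f := fun r : ℝ × E × E => (r.1, r.2.2)) _ hs.contDiffAt (by fun_prop)
  obtain ⟨c, hc, hO⟩ := this.exists_leading hf hα h
  exact ⟨c, hc, by simpa [HasExpansion] using hO⟩

theorem HasExpansion.hasOrderNear (h : HasExpansion α y₀ p s 1 fun _ => 0) :
    HasOrderNear α y₀ (p + 1) s := by
  simpa [HasExpansion, HasOrderNear] using h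

/-- The word `z, w, z` is a palindrome, so the reversed step cancels it one factor at a time, from
the inside out. -/
theorem IsSymmetricNear.jump (hs : IsSmoothFamilyNear y₀ s) (h : IsSymmetricNear y₀ s)
    (z w : ℝ) : IsSymmetricNear y₀ (jump z w s) := by
  have key : ∀ r : ℝ, ∀ᶠ q in 𝓝 ((0 : ℝ), y₀), s (-(r * q.1), s (r * q.1, q.2)) = q.2 :=
    fun r => (tendsto_scale r y₀).eventually h
  have hfst : Tendsto (fun q : ℝ × E => q.1) (𝓝 (0, y₀)) (𝓝 0) :=
    continuous_fst.tendsto' ((0 : ℝ), y₀) 0 rfl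
  have t1 := hfst.prodMk_nhds (hs.scale z).tendsto
  have t2 := hfst.prodMk_nhds ((hs.scale z).comp (hs.scale w)).tendsto
  filter_upwards [key z, t1.eventually (key w), t2.eventually (key z)] with q h1 h2 h3
  simp only [ContactIntegrator.jump, mul_neg] at h1 h2 h3 ⊢
  rw [h3, h2, h1]

/-- A symmetric method of odd order `p` has order `p + 1`. -/
theorem HasOrderNear.succ_of_symmetric (hf : ContDiffAt ℝ ∞ f y₀) (hα : IsFlowNear f α y₀)
    (hs : IsSmoothFamilyNear y₀ s) (hsymm : IsSymmetricNear y₀ s) (hp : Odd p)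
    (h : HasOrderNear α y₀ p s) : HasOrderNear α y₀ (p + 1) s := by
  obtain ⟨c, hc, he⟩ := h.exists_expansion hf hα hs
  -- Expand `s(-τ) ∘ s(τ)` at total time `0`: its coefficient is `c + (-1)^(p+1) c`. By symmetry
  -- this map is the identity, whose coefficient is `0`, so `2c = 0` for odd `p`.
  have h1 := he.comp hf hα (he.scale (-1)) hs.tendsto hc (contDiffAt_const.smul hc)
  have h2 : HasExpansion α y₀ p (fun q => q.2) 0 fun _ => 0 := by
    refine IsBigO.congr' (isBigO_zero _ _) ?_ EventuallyEq.rfl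
    filter_upwards [(continuous_snd.tendsto' ((0 : ℝ), y₀) y₀ rfl).eventually hα.eventually_zero]
      with q hq
    simp [hq]
  have h3 : HasExpansion α y₀ p (fun q => q.2) 0 (fun y => c y + (-1 : ℝ) ^ (p + 1) • c y) := by
    have := h1.congr (t := fun q => q.2) (by
      filter_upwards [hsymm] with q hq
      simpa using hq)
    simpa using this
  have h4 := h3.unique h2
  refine HasExpansion.hasOrderNear (he.congr_coeff ?_)
  filter_upwards [h4] with y hy
  rw [hp.add_one.neg_one_pow, one_smul, ← two_smul ℝ] at hy
  exact (smul_eq_zero.1 hy).resolve_left two_ne_zero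

/-- The triple jump raises the order. -/
theorem HasOrderNear.jump (hf : ContDiffAt ℝ ∞ f y₀) (hα : IsFlowNear f α y₀)
    (hs : IsSmoothFamilyNear y₀ s) (h : HasOrderNear α y₀ p s) {z w : ℝ}
    (h1 : 2 * z + w = 1) (h2 : 2 * z ^ (p + 1) + w ^ (p + 1) = 0) :
    HasOrderNear α y₀ (p + 1) (jump z w s) := by
  obtain ⟨c, hc, he⟩ := h.exists_expansion hf hα hs
  have hz : ContDiffAt ℝ ∞ (fun y => z ^ (p + 1) • c y) y₀ := contDiffAt_const.smul hc
  have hw : ContDiffAt ℝ ∞ (fun y => w ^ (p + 1) • c y) y₀ := contDiffAt_const.smul hc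
  have h3 := (he.scale z).comp hf hα (he.scale w) (hs.scale z).tendsto hz hw
  have h4 := h3.comp hf hα (he.scale z) ((hs.scale z).comp (hs.scale w)).tendsto (hz.add hw) hz
  have h5 : (1 * z + (1 * w + 1 * z)) = 1 := by linarith
  rw [h5] at h4
  refine HasExpansion.hasOrderNear (h4.congr_coeff (Eventually.of_forall fun y => ?_))
  simp only [← add_smul]
  rw [show z ^ (p + 1) + w ^ (p + 1) + z ^ (p + 1) = 0 by linarith, zero_smul]

/-- A consistent method has order `1`. -/
theorem hasOrderNear_one (hf : ContDiffAt ℝ ∞ f y₀) (hα : IsFlowNear f α y₀)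
    (hs : IsSmoothFamilyNear y₀ s)
    (hd : ∀ᶠ y in 𝓝 y₀, HasDerivAt (fun t => s (t, y)) (f y) 0) : HasOrderNear α y₀ 1 s := by
  have hg : IsSmoothAlong α y₀ fun q => s q - α q := by
    refine ⟨fun r => s (r.1, r.2.2) - r.2.1, ?_, EventuallyEq.rfl⟩
    refine ContDiffAt.sub ?_ (by fun_prop)
    exact ContDiffAt.comp (f := fun r : ℝ × E × E => (r.1, r.2.2)) _ hs.contDiffAt (by fun_prop)
  obtain ⟨g', hg', hd'⟩ := hg.exists_deriv hf hα
  obtain ⟨g'', hg'', hd''⟩ := hg'.exists_deriv hf hα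
  have t0 : Tendsto (fun y : E => ((0 : ℝ), y)) (𝓝 y₀) (𝓝 (0, y₀)) :=
    (by fun_prop : Continuous fun y : E => ((0 : ℝ), y)).tendsto' _ _ rfl
  -- The error and its first time derivative vanish at `τ = 0`, and the second derivative is
  -- bounded; integrate twice.
  refine isBigO_pow_of_hasDerivAt (m := 1) ?_ hd'
    (isBigO_pow_of_hasDerivAt (m := 0) ?_ hd'' (by simpa using hg''.isBigO_one hα))
  · filter_upwards [hs.eventually_zero, hα.eventually_zero] with y h1 h2
    rw [h1, h2, sub_self]
  · filter_upwards [hd, t0.eventually hα.eventually_hasDerivAt, t0.eventually hd',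
      hα.eventually_zero] with y h1 h2 h3 h4
    have := h3.unique (h1.sub h2)
    rw [this, h4, sub_self]

/-- The order of the iterated triple jump. -/
theorem hasOrderNear_iterate_jump (hf : ContDiffAt ℝ ∞ f y₀) (hα : IsFlowNear f α y₀)
    (S : ℕ → ℝ × E → E) (hs : IsSmoothFamilyNear y₀ (S 0)) (hsymm : IsSymmetricNear y₀ (S 0))
    (hd : ∀ᶠ y in 𝓝 y₀, HasDerivAt (fun t => S 0 (t, y)) (f y) 0)
    (hS : ∀ k, ∃ z w : ℝ, 2 * z + w = 1 ∧ 2 * z ^ (2 * k + 3) + w ^ (2 * k + 3) = 0 ∧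
      S (k + 1) =ᶠ[𝓝 (0, y₀)] jump z w (S k)) (k : ℕ) :
    HasOrderNear α y₀ (2 * k + 2) (S k) := by
  suffices H : HasOrderNear α y₀ (2 * k + 2) (S k) ∧ IsSmoothFamilyNear y₀ (S k) ∧
      IsSymmetricNear y₀ (S k) from H.1
  induction k with
  | zero =>
    exact ⟨(hasOrderNear_one hf hα hs hd).succ_of_symmetric hf hα hs hsymm odd_one, hs, hsymm⟩
  | succ k ih =>
    obtain ⟨h1, h2, h3⟩ := ih
    obtain ⟨z, w, hzw, hzw', he⟩ := hS k
    have hs' := h2.jump z w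
    have hsymm' := h3.jump h2 z w
    -- The jump lifts `2k + 2` to the odd order `2k + 3`, and symmetry lifts that to `2k + 4`.
    have ho := ((h1.jump hf hα h2 hzw hzw').succ_of_symmetric hf hα hs' hsymm'
      ⟨k + 1, by ring⟩)
    refine ⟨?_, ?_, ?_⟩
    · refine IsBigO.congr' (show HasOrderNear α y₀ _ _ from ho) ?_ EventuallyEq.rfl
      filter_upwards [he] with q hq
      rw [hq]
    · refine ⟨hs'.contDiffAt.congr_of_eventuallyEq he, ?_⟩
      have t0 : Tendsto (fun y : E => ((0 : ℝ), y)) (𝓝 y₀) (𝓝 (0, y₀)) :=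
        (by fun_prop : Continuous fun y : E => ((0 : ℝ), y)).tendsto' _ _ rfl
      filter_upwards [t0.eventually he, hs'.eventually_zero] with y h1 h2
      rw [h1, h2]
    · have t1 : Tendsto (fun q : ℝ × E => (-q.1, ContactIntegrator.jump z w (S k) q))
          (𝓝 (0, y₀)) (𝓝 (0, y₀)) := by
        refine Tendsto.prodMk_nhds ?_ hs'.tendsto
        exact (by fun_prop : Continuous fun q : ℝ × E => -q.1).tendsto' _ _ (by simp)
      filter_upwards [he, hsymm', t1.eventually he] with q h1 h2 h3
      rw [h1, h3, h2]

end Order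

end Expansions

/-! ### The coefficients `z₀`, `z₁` and palindromic lists. -/

section Palindromes

theorem two_rpow_lt_two (k : ℕ) : (2 : ℝ) ^ (1 / (2 * ((k + 1 : ℕ) : ℝ) + 1)) < 2 := by
  conv_rhs => rw [← Real.rpow_one 2]
  refine Real.rpow_lt_rpow_of_exponent_lt one_lt_two ?_
  rw [div_lt_one (by positivity)]
  push_cast
  have : (0 : ℝ) ≤ k := k.cast_nonneg
  linarith

theorem two_mul_z₁_add_z₀ (k : ℕ) : 2 * z₁ (k + 1) + z₀ (k + 1) = 1 := by
  have h : 2 - (2 : ℝ) ^ (1 / (2 * ((k + 1 : ℕ) : ℝ) + 1)) ≠ 0 :=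
    (sub_pos.2 (two_rpow_lt_two k)).ne'
  unfold z₁ z₀
  field_simp
  ring

/-- The numerator of `z₀` is minus the `(2k+3)`-th root of `2`; the power being odd, the sign
survives and the contribution `-2` cancels `2 * 1`. -/
theorem two_mul_z₁_pow_add_z₀_pow (k : ℕ) :
    2 * z₁ (k + 1) ^ (2 * k + 3) + z₀ (k + 1) ^ (2 * k + 3) = 0 := by
  have hr : ((2 : ℝ) ^ (1 / (2 * ((k + 1 : ℕ) : ℝ) + 1))) ^ (2 * k + 3) = 2 := by
    rw [← Real.rpow_natCast, ← Real.rpow_mul two_pos.le]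
    have h3 : (2 * ((k + 1 : ℕ) : ℝ) + 1) = ((2 * k + 3 : ℕ) : ℝ) := by push_cast; ring
    rw [h3, one_div, inv_mul_cancel₀ (by positivity), Real.rpow_one]
  have hodd : Odd (2 * k + 3) := ⟨k + 1, by ring⟩
  unfold z₁ z₀
  rw [hodd.neg_pow, div_pow, div_pow, hr, one_pow]
  ring

variable {M : Type*} [TopologicalSpace M]

/-- The composition of the steps `S (a τ)`, for `a` in a list of coefficients. -/
def listComposition (S : ℝ → OpenPartialHomeomorph M M) (τ : ℝ) :
    List ℝ → OpenPartialHomeomorph M M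
  | [] => OpenPartialHomeomorph.refl M
  | a :: l => (S (a * τ)).trans (listComposition S τ l)

theorem listComposition_append (S : ℝ → OpenPartialHomeomorph M M) (τ : ℝ) (l l' : List ℝ) :
    listComposition S τ (l ++ l') = (listComposition S τ l).trans (listComposition S τ l') := by
  induction l with
  | nil => simp [listComposition]
  | cons a l ih => simp [listComposition, ih, OpenPartialHomeomorph.trans_assoc]

theorem listComposition_map (S : ℝ → OpenPartialHomeomorph M M) (τ z : ℝ) (l : List ℝ) :
    listComposition S τ (l.map (z * ·)) = listComposition S (z * τ) l := by
  induction l with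
  | nil => rfl
  | cons a l ih =>
    simp only [List.map_cons, listComposition, ih]
    rw [show z * a * τ = a * (z * τ) by ring]

/-- The coefficients of the iterated triple jump. -/
noncomputable def tripleJumpCoeffs : ℕ → List ℝ
  | 0 => [1]
  | k + 1 => (tripleJumpCoeffs k).map (z₁ (k + 1) * ·) ++
      ((tripleJumpCoeffs k).map (z₀ (k + 1) * ·) ++ (tripleJumpCoeffs k).map (z₁ (k + 1) * ·))

theorem tripleJump_eq_listComposition (S : ℝ → OpenPartialHomeomorph M M) (k : ℕ) (τ : ℝ) :
    tripleJump S k τ = listComposition S τ (tripleJumpCoeffs k) := by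
  induction k generalizing τ with
  | zero => simp [tripleJump, tripleJumpCoeffs, listComposition]
  | succ k ih =>
    simp only [tripleJump, tripleJumpCoeffs, listComposition_append, listComposition_map, ih]

theorem reverse_tripleJumpCoeffs (k : ℕ) : (tripleJumpCoeffs k).reverse = tripleJumpCoeffs k := by
  induction k with
  | zero => rfl
  | succ k ih => simp [tripleJumpCoeffs, ← List.map_reverse, ih]

/-- The length triples at each stage. Oddness provides the central entry `w 0` of the palindrome. -/
theorem odd_length_tripleJumpCoeffs (k : ℕ) : Odd (tripleJumpCoeffs k).length := by
  induction k with
  | zero => exact odd_one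
  | succ k ih =>
    obtain ⟨j, hj⟩ := ih
    exact ⟨3 * j + 1, by simp [tripleJumpCoeffs, hj]; ring⟩

/-- This becomes the normalization `w 0 = 1 - 2 ∑ w j`. -/
theorem sum_tripleJumpCoeffs (k : ℕ) : (tripleJumpCoeffs k).sum = 1 := by
  induction k with
  | zero => simp [tripleJumpCoeffs]
  | succ k ih =>
    simp only [tripleJumpCoeffs, List.sum_append,
      List.sum_map_mul_left (tripleJumpCoeffs k) (fun x => x), List.map_id', ih, mul_one]
    linarith [two_mul_z₁_add_z₀ k]

/-- The list `w m, …, w 1, w 0, w 1, …, w m`. -/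
def palindrome (w : ℕ → ℝ) : ℕ → List ℝ
  | 0 => [w 0]
  | m + 1 => w (m + 1) :: (palindrome w m ++ [w (m + 1)])

theorem palindrome_congr {w w' : ℕ → ℝ} {m : ℕ} (h : ∀ i ≤ m, w i = w' i) :
    palindrome w m = palindrome w' m := by
  induction m with
  | zero => simp [palindrome, h 0 le_rfl]
  | succ m ih => simp [palindrome, h (m + 1) le_rfl, ih fun i hi => h i (by omega)]

theorem exists_eq_palindrome {l : List ℝ} (h : l.Palindrome) (hl : Odd l.length) :
    ∃ m w, palindrome w m = l := by
  induction h with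
  | nil => simp at hl
  | singleton x => exact ⟨0, fun _ => x, rfl⟩
  | @cons_concat x l _ ih =>
    obtain ⟨m, w, hw⟩ := ih (by
      obtain ⟨j, hj⟩ := hl
      simp only [List.length_cons, List.length_append, List.length_nil] at hj
      exact ⟨j - 1, by omega⟩)
    refine ⟨m + 1, Function.update w (m + 1) x, ?_⟩
    rw [palindrome, Function.update_self, palindrome_congr (w' := w), hw]
    intro i hi
    rw [Function.update_of_ne (by omega)]

theorem sum_palindrome (w : ℕ → ℝ) (m : ℕ) :
    (palindrome w m).sum = w 0 + 2 * ∑ j ∈ Finset.Icc 1 m, w j := by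
  induction m with
  | zero => simp [palindrome]
  | succ m ih =>
    rw [Finset.sum_Icc_succ_top (by omega)]
    simp only [palindrome, List.sum_cons, List.sum_append, List.sum_nil, ih]
    ring

theorem symmetricComposition_eq_listComposition (S : ℝ → OpenPartialHomeomorph M M) (w : ℕ → ℝ)
    (m : ℕ) (τ : ℝ) : symmetricComposition S w m τ = listComposition S τ (palindrome w m) := by
  induction m with
  | zero => simp [symmetricComposition, palindrome, listComposition]
  | succ m ih =>
    simp [symmetricComposition, palindrome, listComposition, listComposition_append, ih]

/-- The iterated triple jump is a symmetric composition. -/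
theorem exists_palindrome_eq_tripleJumpCoeffs (k : ℕ) : ∃ (m : ℕ) (w : ℕ → ℝ),
    w 0 = 1 - 2 * ∑ j ∈ Finset.Icc 1 m, w j ∧ palindrome w m = tripleJumpCoeffs k := by
  obtain ⟨m, w, h⟩ := exists_eq_palindrome
    (List.Palindrome.of_reverse_eq (reverse_tripleJumpCoeffs k)) (odd_length_tripleJumpCoeffs k)
  have h1 := sum_palindrome w m
  rw [h, sum_tripleJumpCoeffs] at h1
  exact ⟨m, w, by linarith, h⟩

end Palindromes

/-! ### Characteristic vectors and nondegeneracy of `a ∧ βⁿ`. -/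

section LinearAlgebra

variable {V : Type*} [AddCommGroup V] [Module ℝ V] {n : ℕ}

/-- Slot `j` enters exactly one factor: `a` if `j = 0`, otherwise the `β` with index `(j - 1) / 2`,
as its first argument for odd `j` and its second for even `j`. -/
theorem exists_linearMap_update (a : V →ₗ[ℝ] ℝ) (β : V →ₗ[ℝ] V →ₗ[ℝ] ℝ)
    (v : Fin (2 * n + 1) → V) (j : Fin (2 * n + 1)) : ∃ L : V →ₗ[ℝ] ℝ, ∀ x,
      a (Function.update v j x 0) * ∏ i : Fin n, β (Function.update v j x ⟨2 * i + 1, by omega⟩)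
        (Function.update v j x ⟨2 * i + 2, by omega⟩) = L x := by
  have hlt := j.2
  by_cases hj : j.1 = 0
  · have hj0 : j = 0 := Fin.ext hj
    subst hj0
    refine ⟨(∏ i : Fin n, β (v ⟨2 * i + 1, by omega⟩) (v ⟨2 * i + 2, by omega⟩)) • a, fun x => ?_⟩
    rw [Function.update_self, LinearMap.smul_apply, smul_eq_mul, mul_comm]
    congr 1
  · set i₀ : Fin n := ⟨(j.1 - 1) / 2, by omega⟩ with hi₀
    have hrest : ∀ x, ∀ i ∈ Finset.univ.erase i₀,
        β (Function.update v j x ⟨2 * i + 1, by omega⟩)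
          (Function.update v j x ⟨2 * i + 2, by omega⟩) =
        β (v ⟨2 * i + 1, by omega⟩) (v ⟨2 * i + 2, by omega⟩) := by
      intro x i hi
      have hne : i.1 ≠ (j.1 - 1) / 2 := fun h => (Finset.ne_of_mem_erase hi) (Fin.ext h)
      rw [Function.update_of_ne, Function.update_of_ne]
      all_goals simp only [ne_eq, Fin.ext_iff]
      all_goals omega
    have h0 : ∀ x, Function.update v j x 0 = v 0 := fun x =>
      Function.update_of_ne (by simp only [ne_eq, Fin.ext_iff, Fin.val_zero]; omega) _ _
    have hprod : ∀ x, a (Function.update v j x 0) *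
        ∏ i : Fin n, β (Function.update v j x ⟨2 * i + 1, by omega⟩)
          (Function.update v j x ⟨2 * i + 2, by omega⟩) =
        (a (v 0) * ∏ i ∈ Finset.univ.erase i₀,
          β (v ⟨2 * i + 1, by omega⟩) (v ⟨2 * i + 2, by omega⟩)) *
        β (Function.update v j x ⟨2 * i₀ + 1, by omega⟩)
          (Function.update v j x ⟨2 * i₀ + 2, by omega⟩) := by
      intro x
      rw [← Finset.mul_prod_erase _ _ (Finset.mem_univ i₀), Finset.prod_congr rfl (hrest x), h0]
      ring
    simp only [hprod]
    by_cases hodd : j.1 % 2 = 1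
    · have h1 : (⟨2 * i₀.1 + 1, by omega⟩ : Fin (2 * n + 1)) = j := by
        ext; simp only [hi₀]; omega
      have h2 : (⟨2 * i₀.1 + 2, by omega⟩ : Fin (2 * n + 1)) ≠ j := by
        simp only [ne_eq, Fin.ext_iff, hi₀]; omega
      refine ⟨(a (v 0) * ∏ i ∈ Finset.univ.erase i₀,
          β (v ⟨2 * i + 1, by omega⟩) (v ⟨2 * i + 2, by omega⟩)) •
          β.flip (v ⟨2 * i₀.1 + 2, by omega⟩), fun x => ?_⟩
      rw [Function.update_of_ne h2, h1, Function.update_self, LinearMap.smul_apply,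
        LinearMap.flip_apply, smul_eq_mul]
    · have h1 : (⟨2 * i₀.1 + 1, by omega⟩ : Fin (2 * n + 1)) ≠ j := by
        simp only [ne_eq, Fin.ext_iff, hi₀]; omega
      have h2 : (⟨2 * i₀.1 + 2, by omega⟩ : Fin (2 * n + 1)) = j := by
        ext; simp only [hi₀]; omega
      refine ⟨(a (v 0) * ∏ i ∈ Finset.univ.erase i₀,
          β (v ⟨2 * i + 1, by omega⟩) (v ⟨2 * i + 2, by omega⟩)) •
          β (v ⟨2 * i₀.1 + 1, by omega⟩), fun x => ?_⟩
      rw [Function.update_of_ne h1, h2, Function.update_self, LinearMap.smul_apply, smul_eq_mul]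

/-- The multilinear map whose alternatization is `a ∧ β ^ n`, up to a factor. -/
def volumeMultilinear (a : V →ₗ[ℝ] ℝ) (β : V →ₗ[ℝ] V →ₗ[ℝ] ℝ) (n : ℕ) :
    MultilinearMap ℝ (fun _ : Fin (2 * n + 1) => V) ℝ where
  toFun v := a (v 0) * ∏ i : Fin n, β (v ⟨2 * i + 1, by omega⟩) (v ⟨2 * i + 2, by omega⟩)
  map_update_add' := by
    intro inst v j x y
    rw [Subsingleton.elim inst (instDecidableEqFin _)]
    obtain ⟨L, hL⟩ := exists_linearMap_update a β v j
    simp only [hL, map_add]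
  map_update_smul' := by
    intro inst v j r x
    rw [Subsingleton.elim inst (instDecidableEqFin _)]
    obtain ⟨L, hL⟩ := exists_linearMap_update a β v j
    simp only [hL, map_smul]

theorem volumeMultilinear_apply (a : V →ₗ[ℝ] ℝ) (β : V →ₗ[ℝ] V →ₗ[ℝ] ℝ)
    (v : Fin (2 * n + 1) → V) : volumeMultilinear a β n v =
      a (v 0) * ∏ i : Fin n, β (v ⟨2 * i + 1, by omega⟩) (v ⟨2 * i + 2, by omega⟩) := rfl

/-- The index paired with a given one in `volumeMultilinear`. -/
def partner (p : Fin (2 * n + 1)) : Fin (2 * n + 1) :=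
  -- The slot of `a` is unpaired and is sent to itself by convention. The reduction modulo `2n + 1`
  -- only supplies the bound: an odd `p` is at most `2n - 1`.
  if p.1 = 0 then 0 else if p.1 % 2 = 1 then ⟨(p.1 + 1) % (2 * n + 1), Nat.mod_lt _ (by omega)⟩
    else ⟨p.1 - 1, by omega⟩

theorem partner_ne {p : Fin (2 * n + 1)} (hp : p ≠ 0) : partner p ≠ p ∧ partner p ≠ 0 := by
  have h0 : p.1 ≠ 0 := fun h => hp (Fin.ext h)
  have hlt := p.2
  unfold partner
  rw [if_neg h0]
  split_ifs with h
  · have : (p.1 + 1) % (2 * n + 1) = p.1 + 1 := Nat.mod_eq_of_lt (by omega)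
    simp only [ne_eq, Fin.ext_iff, this, Fin.val_zero]
    omega
  · simp only [ne_eq, Fin.ext_iff, Fin.val_zero]
    omega

/-- Swapping the argument of `a` with the partner of a characteristic vector. -/
theorem volumeMultilinear_comp_swap {a : V →ₗ[ℝ] ℝ} {β : V →ₗ[ℝ] V →ₗ[ℝ] ℝ} {Z : V} {ρ : ℝ}
    (hβ : ∀ u v, β u v = -β v u) (hZ : ∀ v, β Z v = ρ * a v)
    (v : Fin (2 * n + 1) → V) {p : Fin (2 * n + 1)} (hp : p ≠ 0) (hv : v p = Z) :
    volumeMultilinear a β n (v ∘ Equiv.swap 0 (partner p)) = volumeMultilinear a β n v := by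
  have hZ' : ∀ v, β v Z = -(ρ * a v) := fun v => by rw [hβ, hZ]
  have h0 : p.1 ≠ 0 := fun h => hp (Fin.ext h)
  have hlt := p.2
  obtain ⟨hpp, hp0⟩ := partner_ne hp
  have hsp : Equiv.swap 0 (partner p) p = p := Equiv.swap_apply_of_ne_of_ne hp hpp.symm
  have hi : (p.1 - 1) / 2 < n := by omega
  set i₀ : Fin n := ⟨(p.1 - 1) / 2, hi⟩ with hi₀
  have hval : (partner p).1 = if p.1 % 2 = 1 then p.1 + 1 else p.1 - 1 := by
    unfold partner
    rw [if_neg h0]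
    split_ifs with h
    · exact Nat.mod_eq_of_lt (by omega)
    · rfl
  have hrest : ∀ i ∈ Finset.univ.erase i₀,
      β ((v ∘ Equiv.swap 0 (partner p)) ⟨2 * i + 1, by omega⟩)
        ((v ∘ Equiv.swap 0 (partner p)) ⟨2 * i + 2, by omega⟩) =
      β (v ⟨2 * i + 1, by omega⟩) (v ⟨2 * i + 2, by omega⟩) := by
    intro i hi
    have hne : i.1 ≠ (p.1 - 1) / 2 := fun h => (Finset.ne_of_mem_erase hi) (Fin.ext h)
    simp only [Function.comp]
    rw [Equiv.swap_apply_of_ne_of_ne, Equiv.swap_apply_of_ne_of_ne]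
    all_goals simp only [ne_eq, Fin.ext_iff, Fin.val_zero, hval]
    all_goals first | omega | (split_ifs <;> omega)
  simp only [volumeMultilinear_apply]
  rw [← Finset.mul_prod_erase _ _ (Finset.mem_univ i₀), Finset.prod_congr rfl hrest,
    ← Finset.mul_prod_erase Finset.univ (fun i : Fin n => β (v ⟨2 * i + 1, by omega⟩)
      (v ⟨2 * i + 2, by omega⟩)) (Finset.mem_univ i₀)]
  simp only [Function.comp, Equiv.swap_apply_left]
  -- As `ι_Z β = ρ a`, the pair containing `Z` contributes `±ρ a(v (partner p))`, and its product
  -- with `a(v 0)` is symmetric in the two swapped slots.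
  by_cases hodd : p.1 % 2 = 1
  · have h1 : (⟨2 * i₀.1 + 1, by omega⟩ : Fin (2 * n + 1)) = p := by
      ext; simp only [hi₀]; omega
    have h2 : (⟨2 * i₀.1 + 2, by omega⟩ : Fin (2 * n + 1)) = partner p := by
      ext; simp only [hi₀, hval, if_pos hodd]; omega
    rw [h1, h2, hsp, Equiv.swap_apply_right, hv, hZ, hZ]
    ring
  · have h1 : (⟨2 * i₀.1 + 1, by omega⟩ : Fin (2 * n + 1)) = partner p := by
      ext; simp only [hi₀, hval, if_neg hodd]; omega
    have h2 : (⟨2 * i₀.1 + 2, by omega⟩ : Fin (2 * n + 1)) = p := by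
      ext; simp only [hi₀]; omega
    rw [h1, h2, hsp, Equiv.swap_apply_right, hv, hZ', hZ']
    ring

/-- A characteristic vector annihilates `a ∧ β ^ n`. -/
theorem alternatization_volumeMultilinear_eq_zero {a : V →ₗ[ℝ] ℝ} {β : V →ₗ[ℝ] V →ₗ[ℝ] ℝ} {Z : V}
    {ρ : ℝ} (hβ : ∀ u v, β u v = -β v u) (hZ : ∀ v, β Z v = ρ * a v) (ha : a Z = 0)
    (v : Fin (2 * n + 1) → V) {j : Fin (2 * n + 1)} (hv : v j = Z) :
    MultilinearMap.alternatization (volumeMultilinear a β n) v = 0 := by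
  rw [MultilinearMap.alternatization_apply]
  have hs : ∀ σ : Equiv.Perm (Fin (2 * n + 1)), σ⁻¹ j = 0 →
      volumeMultilinear a β n (fun i => v (σ i)) = 0 := by
    intro σ hσ
    have : σ 0 = j := by rw [← hσ]; simp
    simp [volumeMultilinear_apply, this, hv, ha]
  have key : ∀ σ : Equiv.Perm (Fin (2 * n + 1)), σ⁻¹ j ≠ 0 →
      volumeMultilinear a β n (fun i => v ((σ * Equiv.swap 0 (partner (σ⁻¹ j))) i)) =
        volumeMultilinear a β n (fun i => v (σ i)) := fun σ hσ =>
    volumeMultilinear_comp_swap hβ hZ (v ∘ σ) hσ (by simp [hv])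
  have hinv : ∀ σ : Equiv.Perm (Fin (2 * n + 1)),
      (σ * Equiv.swap 0 (partner (σ⁻¹ j)))⁻¹ j = σ⁻¹ j := by
    intro σ
    by_cases h : σ⁻¹ j = 0
    · rw [h]
      simp only [partner, Fin.val_zero, if_true, Equiv.swap_self]
      simpa using h
    · rw [mul_inv_rev, Equiv.Perm.mul_apply, Equiv.swap_inv]
      exact Equiv.swap_apply_of_ne_of_ne h (partner_ne h).1.symm
  -- A sign-reversing involution: if `Z` sits in the slot of `a`, the term is zero since `a Z = 0`;
  -- otherwise swapping slot `0` with the partner of `Z` preserves the product and flips the sign.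
  refine Finset.sum_involution (fun σ _ => σ * Equiv.swap 0 (partner (σ⁻¹ j))) ?_ ?_
    (fun _ _ => Finset.mem_univ _) ?_
  · intro σ _
    simp only [MultilinearMap.domDomCongr_apply]
    by_cases h : σ⁻¹ j = 0
    · have h1 := hs σ h
      have h2 := hs (σ * Equiv.swap 0 (partner (σ⁻¹ j))) (by rw [hinv, h])
      rw [h1, h2]; simp
    · have h1 := key σ h
      rw [h1, Equiv.Perm.sign_mul, Equiv.Perm.sign_swap (partner_ne h).2.symm]
      simp
  · intro σ _ hne heq
    by_cases h : σ⁻¹ j = 0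
    · apply hne
      have h1 := hs σ h
      rw [MultilinearMap.domDomCongr_apply, h1, smul_zero]
    · have : Equiv.swap 0 (partner (σ⁻¹ j)) = 1 := mul_eq_left.1 heq
      rw [Equiv.Perm.one_def, Equiv.swap_eq_refl_iff] at this
      exact (partner_ne h).2 this.symm
  · intro σ _
    simp only [hinv, mul_assoc, Equiv.swap_mul_self, mul_one]

/-- Nondegeneracy: if `a ∧ β ^ n ≠ 0`, then a vector `Z` with `a Z = 0` and `ι_Z β` proportional
to `a` vanishes. -/
theorem eq_zero_of_alternatization_ne_zero {a : V →ₗ[ℝ] ℝ} {β : V →ₗ[ℝ] V →ₗ[ℝ] ℝ} {Z : V} {ρ : ℝ}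
    (hdim : Module.finrank ℝ V = 2 * n + 1)
    (hβ : ∀ u v, β u v = -β v u) (hZ : ∀ v, β Z v = ρ * a v) (ha : a Z = 0)
    {v : Fin (2 * n + 1) → V}
    (hv : MultilinearMap.alternatization (volumeMultilinear a β n) v ≠ 0) : Z = 0 := by
  have hli : LinearIndependent ℝ v := by
    by_contra h
    exact hv (AlternatingMap.map_linearDependent _ v h)
  let b := basisOfLinearIndependentOfCardEqFinrank hli (by simp [hdim])
  have hb : ∀ i, b i = v i := fun i => by simp [b]
  refine b.repr.map_eq_zero_iff.1 (Finsupp.ext fun j => ?_)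
  -- Put `Z` in place of `v j` and expand it in the basis `v`: only the `j`-th coordinate survives
  -- alternation, multiplied by the nonzero value at `v`, so this coordinate is `0`.
  have h0 := alternatization_volumeMultilinear_eq_zero hβ hZ ha (Function.update v j Z)
    (Function.update_self j Z v)
  have hsum : Z = ∑ i, b.repr Z i • v i := by
    conv_lhs => rw [← b.sum_repr Z]
    simp [hb]
  rw [hsum, ← AlternatingMap.coe_multilinearMap, MultilinearMap.map_update_sum,
    Finset.sum_eq_single j] at h0
  · rw [MultilinearMap.map_update_smul, Function.update_eq_self] at h0
    exact (smul_eq_zero.1 h0).resolve_right hv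
  · intro i _ hij
    rw [MultilinearMap.map_update_smul, AlternatingMap.coe_multilinearMap,
      AlternatingMap.map_update_self _ _ hij.symm, smul_zero]
  · simp

end LinearAlgebra

/-! ### Coordinate formulas for forms and fields, and additivity of contact Hamiltonian fields. -/

section Representations

variable {n : ℕ} {M : Type*} [TopologicalSpace M] [ChartedSpace (Model n) M]

theorem differentiableAt_formRep {η : ∀ x : M, TangentSpace (𝓡 (2 * n + 1)) x →L[ℝ] ℝ}
    (hη : IsSmoothForm η) (x : M) :
    DifferentiableAt ℝ (formRep η x) (extChartAt (𝓡 (2 * n + 1)) x x) :=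
  ((hη x).contDiffAt (extChartAt_target_mem_nhds x)).differentiableAt (by simp)

variable [IsManifold (𝓡 (2 * n + 1)) ∞ M]

theorem vecRep_apply (x : M) (v : TangentSpace (𝓡 (2 * n + 1)) x) : vecRep x v = v := by
  have : IsManifold (𝓡 (2 * n + 1)) 1 M := .of_le (n := ∞) (by exact_mod_cast le_top)
  unfold vecRep
  rw [mfderiv_extChartAt_self]
  rfl

theorem formRep_apply_fieldRep (η : ∀ x : M, TangentSpace (𝓡 (2 * n + 1)) x →L[ℝ] ℝ)
    (X : ∀ x : M, TangentSpace (𝓡 (2 * n + 1)) x) (x₀ : M) {y : Model n}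
    (hy : y ∈ (extChartAt (𝓡 (2 * n + 1)) x₀).target) :
    formRep η x₀ y (fieldRep X x₀ y) = η ((extChartAt (𝓡 (2 * n + 1)) x₀).symm y) (X _) := by
  have : IsManifold (𝓡 (2 * n + 1)) 1 M := .of_le (n := ∞) (by exact_mod_cast le_top)
  have h := mfderivWithin_extChartAt_symm_comp_mfderiv_extChartAt (I := 𝓡 (2 * n + 1)) hy
  rw [ModelWithCorners.range_eq_univ, mfderivWithin_univ] at h
  have h1 := DFunLike.congr_fun h (X ((extChartAt (𝓡 (2 * n + 1)) x₀).symm y))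
  exact congrArg (η ((extChartAt (𝓡 (2 * n + 1)) x₀).symm y)) h1

theorem fieldRep_self (X : ∀ x : M, TangentSpace (𝓡 (2 * n + 1)) x) (x : M) :
    fieldRep X x (extChartAt (𝓡 (2 * n + 1)) x x) = X x := by
  -- The type of `X x'` depends on the base point, so it is generalized before the equation is
  -- substituted.
  have h : ∀ x', x' = x → (mfderiv (𝓡 (2 * n + 1)) 𝓘(ℝ, Model n) (extChartAt (𝓡 (2 * n + 1)) x) x'
    (X x') : Model n) = vecRep x (X x) := by rintro _ rfl; rfl
  exact (h _ (extChartAt_to_inv x)).trans (vecRep_apply x (X x))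

theorem formRep_self (η : ∀ x : M, TangentSpace (𝓡 (2 * n + 1)) x →L[ℝ] ℝ) (x : M) 
   (v : Model n) : formRep η x (extChartAt (𝓡 (2 * n + 1)) x x) v = η x v := by
  have := formRep_apply_fieldRep η (fun _ => v) x (mem_extChartAt_target x)
  refine (congrArg (formRep η x _) (fieldRep_self (fun _ => v) x)).symm.trans (this.trans ?_)
  have h : ∀ x', x' = x → η x' v = η x v := by rintro _ rfl; rfl
  exact h _ (extChartAt_to_inv x)

/-- On the chart domain the coordinates of `X` are its components in the tangent bundle
trivialization at `x₀`, in which smoothness of a section can be tested. -/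
theorem contDiffOn_fieldRep {X : ∀ x : M, TangentSpace (𝓡 (2 * n + 1)) x} (hX : IsSmoothField X)
    (x₀ : M) : ContDiffOn ℝ ∞ (fieldRep X x₀) (extChartAt (𝓡 (2 * n + 1)) x₀).target := by
  have : IsManifold (𝓡 (2 * n + 1)) 1 M := .of_le (n := ∞) (by exact_mod_cast le_top)
  rw [← contMDiffOn_iff_contDiffOn]
  have h1 : ContMDiffOn (𝓡 (2 * n + 1)) 𝓘(ℝ, Model n) ∞
      (fun x => ((mfderiv (𝓡 (2 * n + 1)) 𝓘(ℝ, Model n) (extChartAt (𝓡 (2 * n + 1)) x₀) x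
    (X x)) : Model n)) (extChartAt (𝓡 (2 * n + 1)) x₀).source := by
    intro x hx
    rw [extChartAt_source] at hx
    have hb : x ∈ (trivializationAt (Model n) (TangentSpace (𝓡 (2 * n + 1))) x₀).baseSet := by
      simpa using hx
    have h2 := (Bundle.Trivialization.contMDiffAt_section_iff
      (IB := 𝓡 (2 * n + 1)) (n := ∞) (s := X)
     (trivializationAt (Model n) (TangentSpace (𝓡 (2 * n + 1))) x₀) hb).1 (hX x)
    refine (h2.congr_of_eventuallyEq ?_).contMDiffWithinAt
    filter_upwards [(chartAt (Model n) x₀).open_source.mem_nhds hx] with z hz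
    have hb : z ∈ (trivializationAt (Model n) (TangentSpace (𝓡 (2 * n + 1))) x₀).baseSet := by
      simpa using hz
    refine (DFunLike.congr_fun (TangentBundle.continuousLinearMapAt_trivializationAt hz)
      (X z)).symm.trans ?_
    exact congrFun (Bundle.Trivialization.coe_linearMapAt_of_mem (R := ℝ) _ hb) (X z)
  exact h1.comp (contMDiffOn_extChartAt_symm x₀) fun y hy =>
    (extChartAt (𝓡 (2 * n + 1)) x₀).map_target hy

theorem differentiableAt_fieldRep {X : ∀ x : M, TangentSpace (𝓡 (2 * n + 1)) x}
    (hX : IsSmoothField X) (x : M) :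
    DifferentiableAt ℝ (fieldRep X x) (extChartAt (𝓡 (2 * n + 1)) x x) :=
  ((contDiffOn_fieldRep hX x).contDiffAt (extChartAt_target_mem_nhds x)).differentiableAt (by simp)

theorem lieDer_apply (X : ∀ x : M, TangentSpace (𝓡 (2 * n + 1)) x)
    (η : ∀ x : M, TangentSpace (𝓡 (2 * n + 1)) x →L[ℝ] ℝ) (x : M) (v : Model n) :
    lieDer X η x v = fderiv ℝ (formRep η x) (extChartAt (𝓡 (2 * n + 1)) x x)
        (fieldRep X x (extChartAt (𝓡 (2 * n + 1)) x x)) v +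
      formRep η x (extChartAt (𝓡 (2 * n + 1)) x x)
        (fderiv ℝ (fieldRep X x) (extChartAt (𝓡 (2 * n + 1)) x x) v) := by
  have h : vecRep x (X x) = fieldRep X x (extChartAt (𝓡 (2 * n + 1)) x x) :=
    (vecRep_apply x (X x)).trans (fieldRep_self X x).symm
  have h' : vecRep x v = v := vecRep_apply x v
  unfold lieDer
  rw [h, h']

theorem extDer_apply (η : ∀ x : M, TangentSpace (𝓡 (2 * n + 1)) x →L[ℝ] ℝ) (x : M)
    (v w : Model n) : extDer η x v w =
      fderiv ℝ (formRep η x) (extChartAt (𝓡 (2 * n + 1)) x x) v w -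
        fderiv ℝ (formRep η x) (extChartAt (𝓡 (2 * n + 1)) x x) w v := by
  have hv : vecRep x v = v := vecRep_apply x v
  have hw : vecRep x w = w := vecRep_apply x w
  unfold extDer
  rw [hv, hw]

/-- A tangent vector in the kernel of a contact form `η` whose interior product with `dη` is
proportional to `η` vanishes. -/
theorem eq_zero_of_extDer_eq {η : ∀ x : M, TangentSpace (𝓡 (2 * n + 1)) x →L[ℝ] ℝ} {x : M}
    (hη : ∃ v : Fin (2 * n + 1) → TangentSpace (𝓡 (2 * n + 1)) x, volumeForm η x v ≠ 0)
    {Z : Model n} {ρ : ℝ} (h0 : η x Z = 0) (h : ∀ v : Model n, extDer η x Z v = ρ * η x v) :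
    Z = 0 := by
  obtain ⟨v, hv⟩ : ∃ v : Fin (2 * n + 1) → Model n, volumeForm η x v ≠ 0 := hη
  let D : Model n →L[ℝ] Model n →L[ℝ] ℝ :=
    fderiv ℝ (formRep η x) (extChartAt (𝓡 (2 * n + 1)) x x)
  let a : Model n →L[ℝ] ℝ := η x
  let β : Model n →ₗ[ℝ] Model n →ₗ[ℝ] ℝ := LinearMap.mk₂ ℝ (fun v w => D v w - D w v)
    (fun _ _ _ => by simp only [map_add, add_apply]; ring)
    (fun _ _ _ => by simp only [map_smul, smul_apply, smul_eq_mul]; ring)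
    (fun _ _ _ => by simp only [map_add, add_apply]; ring)
    (fun _ _ _ => by simp only [map_smul, smul_apply, smul_eq_mul]; ring)
  have hβ : ∀ v w : Model n, extDer η x v w = β v w := extDer_apply η x
  refine eq_zero_of_alternatization_ne_zero (n := n) (a := a.toLinearMap) (β := β) (ρ := ρ) (v := v)
    (by simp) (fun u v => ?_) (fun v => ?_) h0 ?_
  · simp only [β, LinearMap.mk₂_apply]; ring
  · rw [← hβ]; exact h v
  · refine fun h0 => hv (Eq.trans ?_ h0)
    rw [MultilinearMap.alternatization_apply]
    unfold volumeForm
    refine Finset.sum_congr rfl fun σ _ => ?_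
    rw [MultilinearMap.domDomCongr_apply, volumeMultilinear_apply, Units.smul_def, zsmul_eq_mul]
    exact congrArg _ (congrArg _ (Finset.prod_congr rfl fun i _ => hβ _ _))

/-- The contact Hamiltonian vector field of a sum. -/
theorem IsContactHamiltonianField.eq_sum {ι : Type*} [Fintype ι]
    {η : ∀ x : M, TangentSpace (𝓡 (2 * n + 1)) x →L[ℝ] ℝ} (hη : IsContactForm η)
    {H : M → ℝ} {φ : ι → M → ℝ} (hH : ∀ x, H x = ∑ j, φ j x)
    {X : ∀ x : M, TangentSpace (𝓡 (2 * n + 1)) x} (hX : IsContactHamiltonianField η H X)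
    {Y : ι → ∀ x : M, TangentSpace (𝓡 (2 * n + 1)) x}
    (hY : ∀ j, IsContactHamiltonianField η (φ j) (Y j)) (x : M) : X x = ∑ j, Y j x := by
  obtain ⟨ρ, hρ⟩ := hX.lieDer_eq
  choose r hr using fun j => (hY j).lieDer_eq
  set y₀ := extChartAt (𝓡 (2 * n + 1)) x x with hy₀
  have dX := differentiableAt_fieldRep hX.smooth x
  have dY := fun j => differentiableAt_fieldRep (hY j).smooth x
  have dη := differentiableAt_formRep hη.smooth x
  let Z : Model n → Model n := fun y => fieldRep X x y - ∑ j, fieldRep (Y j) x y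
  have dZ : HasFDerivAt Z (fderiv ℝ (fieldRep X x) y₀ - ∑ j, fderiv ℝ (fieldRep (Y j) x) y₀) y₀ :=
    dX.hasFDerivAt.sub (HasFDerivAt.fun_sum fun j _ => (dY j).hasFDerivAt)
  have hzero : (fun y => formRep η x y (Z y)) =ᶠ[𝓝 y₀] fun _ => 0 := by
    filter_upwards [extChartAt_target_mem_nhds (I := 𝓡 (2 * n + 1)) x] with y hy
    simp only [Z, map_sub, map_sum]
    rw [formRep_apply_fieldRep η X x hy, hX.apply_eq, hH]
    simp only [fun j => formRep_apply_fieldRep η (Y j) x hy, fun j => (hY j).apply_eq]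
    simp
  have hder := (dη.hasFDerivAt.clm_apply dZ).unique
    ((hasFDerivAt_const (0 : ℝ) y₀).congr_of_eventuallyEq hzero)
  have hZ0 : formRep η x y₀ (Z y₀) = 0 := hzero.self_of_nhds
  have hZ : Z y₀ = 0 := by
    -- Cartan's formula `£_Z η = ι_Z dη + d(η(Z))` in coordinates: `e1` and `e2` give the Lie
    -- derivatives, and `e3` is the vanishing of `d(η(Z))`.
    refine eq_zero_of_extDer_eq (hη.nondegenerate x) (ρ := ρ x - ∑ j, r j x)
      ((formRep_self η x _).symm.trans hZ0) fun v => ?_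
    have e1 := (lieDer_apply X η x v).symm.trans (hρ x v)
    have e2 := fun j => (lieDer_apply (Y j) η x v).symm.trans (hr j x v)
    have e3 := DFunLike.congr_fun hder v
    have e4 : ∑ j, (fderiv ℝ (formRep η x) y₀ (fieldRep (Y j) x y₀) v +
      formRep η x y₀ (fderiv ℝ (fieldRep (Y j) x) y₀ v)) = ∑ j, r j x * η x v :=
      Finset.sum_congr rfl fun j _ => e2 j
    have e5 : extDer η x (Z y₀) v = fderiv ℝ (formRep η x) y₀ (Z y₀) v -
        fderiv ℝ (formRep η x) y₀ v (Z y₀) :=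
      extDer_apply η x (Z y₀) v
    have e6 : fderiv ℝ (formRep η x) y₀ (Z y₀) v =
        fderiv ℝ (formRep η x) y₀ (fieldRep X x y₀) v -
          ∑ j, fderiv ℝ (formRep η x) y₀ (fieldRep (Y j) x y₀) v := by
      simp [Z]
    rw [e5, e6, sub_mul, Finset.sum_mul]
    rw [Finset.sum_add_distrib] at e4
    simp only [add_apply, ContinuousLinearMap.comp_apply,
      sub_apply, sum_apply, ContinuousLinearMap.flip_apply,
      map_sub, map_sum, zero_apply] at e3
    linarith
  have h1 : fieldRep X x y₀ = ∑ j, fieldRep (Y j) x y₀ := sub_eq_zero.1 hZ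
  rw [fieldRep_self] at h1
  refine h1.trans (Finset.sum_congr rfl fun j _ => fieldRep_self (Y j) x)

end Representations

/-! ### Linear equations along a flow and the derivative of a pullback. -/

section FlowCalculus

/-- A solution of a family of scalar linear equations with a common coefficient that vanishes once
vanishes identically, provided that at each time some member of the family does not vanish. -/
theorem eq_zero_of_hasDerivAt_mul {V : Type*} {J : Set ℝ} (hJ : IsOpen J) (hJc : IsPreconnected J)
    {g : V → ℝ → ℝ} {ρ : ℝ → ℝ} (hg : ∀ v, ∀ s ∈ J, HasDerivAt (g v) (ρ s * g v s) s)
    (hne : ∀ s ∈ J, ∃ w, g w s ≠ 0) {v : V} {s₀ : ℝ} (hs₀ : s₀ ∈ J) (hv : g v s₀ = 0) :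
    ∀ s ∈ J, g v s = 0 := by
  -- Nothing is assumed about the regularity of `ρ`, so uniqueness for linear equations is avoided:
  -- near `s` the quotient `g v / g w` has derivative `0`, hence is constant.
  have hloc : ∀ s ∈ J, g v s = 0 → ∀ᶠ t in 𝓝 s, g v t = 0 := by
    intro s hs h0
    obtain ⟨w, hw⟩ := hne s hs
    have h1 : ∀ᶠ t in 𝓝 s, t ∈ J ∧ g w t ≠ 0 :=
      (hJ.eventually_mem hs).and ((hg w s hs).continuousAt.eventually_ne hw)
    obtain ⟨ε, hε, hball⟩ := Metric.eventually_nhds_iff_ball.1 h1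
    have hd : ∀ t ∈ Metric.ball s ε, HasDerivAt (fun t => g v t / g w t) 0 t := by
      intro t ht
      obtain ⟨htJ, htw⟩ := hball t ht
      refine ((hg v t htJ).div (hg w t htJ) htw).congr_deriv ?_
      rw [div_eq_zero_iff]; left; ring
    filter_upwards [Metric.ball_mem_nhds s hε] with t ht
    have := Metric.isOpen_ball.is_const_of_deriv_eq_zero (convex_ball s ε).isPreconnected
      (fun t ht => (hd t ht).differentiableAt.differentiableWithinAt)
      (fun t ht => (hd t ht).deriv) ht (Metric.mem_ball_self hε)
    rw [h0, zero_div] at this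
    exact (div_eq_zero_iff.1 this).resolve_right (hball t ht).2
  -- The set of times near which `g v` vanishes is open, and closed in `J` by continuity; `J` is
  -- connected.
  have hsub : J ⊆ {s | ∀ᶠ t in 𝓝 s, g v t = 0} := by
    refine hJc.subset_of_closure_inter_subset isOpen_setOfPred_eventually_nhds
      ⟨s₀, hs₀, hloc s₀ hs₀ hv⟩ ?_
    rintro s ⟨hs, hsJ⟩
    refine hloc s hsJ ?_
    by_contra hne0
    obtain ⟨t, ht1, ht2⟩ := mem_closure_iff_nhds.1 hs _
      ((hg v s hsJ).continuousAt.eventually_ne hne0)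
    exact ht1 ht2.self_of_nhds
  exact fun s hs => (hsub hs).self_of_nhds

/-- The time derivative of the pullback of a form by a flow. -/
theorem hasDerivAt_pullback {E F : Type*} [NormedAddCommGroup E] [NormedSpace ℝ E]
    [NormedAddCommGroup F] [NormedSpace ℝ F] {f : ℝ × E → F} {X : F → F} {θ : F → F →L[ℝ] ℝ}
    {s₀ : ℝ} {y₀ : E} (hf : ContDiffAt ℝ 2 f (s₀, y₀)) (hX : DifferentiableAt ℝ X (f (s₀, y₀)))
    (hθ : DifferentiableAt ℝ θ (f (s₀, y₀)))
    (hflow : ∀ᶠ q in 𝓝 (s₀, y₀), fderiv ℝ f q (1, 0) = X (f q)) (v : E) :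
    HasDerivAt (fun s => θ (f (s, y₀)) (fderiv ℝ f (s, y₀) (0, v)))
      (fderiv ℝ θ (f (s₀, y₀)) (X (f (s₀, y₀))) (fderiv ℝ f (s₀, y₀) (0, v)) +
        θ (f (s₀, y₀)) (fderiv ℝ X (f (s₀, y₀)) (fderiv ℝ f (s₀, y₀) (0, v)))) s₀ := by
  have hfd : DifferentiableAt ℝ f (s₀, y₀) := hf.differentiableAt (by simp)
  have hfd2 : DifferentiableAt ℝ (fderiv ℝ f) (s₀, y₀) :=
    (hf.fderiv_right (m := 1) (by norm_num)).differentiableAt (by simp)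
  have hline : HasDerivAt (fun s : ℝ => (s, y₀)) ((1 : ℝ), (0 : E)) s₀ :=
    (hasDerivAt_id s₀).prodMk (hasDerivAt_const _ _)
  have h1 : HasDerivAt (fun s => f (s, y₀)) (X (f (s₀, y₀))) s₀ := by
    rw [← hflow.self_of_nhds]
    exact hfd.hasFDerivAt.comp_hasDerivAt s₀ hline
  have h2 : HasDerivAt (fun s => θ (f (s, y₀))) (fderiv ℝ θ (f (s₀, y₀)) (X (f (s₀, y₀)))) s₀ :=
    hθ.hasFDerivAt.comp_hasDerivAt s₀ h1
  have h3 : HasDerivAt (fun s => fderiv ℝ f (s, y₀))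
      (fderiv ℝ (fderiv ℝ f) (s₀, y₀) (1, 0)) s₀ :=
    hfd2.hasFDerivAt.comp_hasDerivAt s₀ hline
  -- Symmetry of the second derivative exchanges `∂ₛ` with the spatial derivative, and `∂ₛ f = X ∘
  -- f`.
  have h4 : fderiv ℝ (fderiv ℝ f) (s₀, y₀) (1, 0) (0, v) =
      fderiv ℝ X (f (s₀, y₀)) (fderiv ℝ f (s₀, y₀) (0, v)) := by
    have hsymm : IsSymmSndFDerivAt ℝ f (s₀, y₀) := hf.isSymmSndFDerivAt (by simp)
    rw [hsymm.eq]
    have e1 : HasFDerivAt (fun q => fderiv ℝ f q (1, 0))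
        ((ContinuousLinearMap.apply ℝ F ((1 : ℝ), (0 : E))).comp
          (fderiv ℝ (fderiv ℝ f) (s₀, y₀))) (s₀, y₀) :=
      (ContinuousLinearMap.apply ℝ F ((1 : ℝ), (0 : E))).hasFDerivAt.comp _ hfd2.hasFDerivAt
    have e2 : HasFDerivAt (fun q => X (f q))
        ((fderiv ℝ X (f (s₀, y₀))).comp (fderiv ℝ f (s₀, y₀))) (s₀, y₀) :=
      hX.hasFDerivAt.comp _ hfd.hasFDerivAt
    have e3 := e1.unique (e2.congr_of_eventuallyEq hflow)
    exact DFunLike.congr_fun e3 (0, v)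
  have h5 : HasDerivAt (fun s => fderiv ℝ f (s, y₀) (0, v))
      (fderiv ℝ X (f (s₀, y₀)) (fderiv ℝ f (s₀, y₀) (0, v))) s₀ := by
    rw [← h4]
    exact ((ContinuousLinearMap.apply ℝ F ((0 : ℝ), v)).hasFDerivAt.comp_hasDerivAt s₀ h3)
  exact h2.clm_apply h5

end FlowCalculus

/-! ### Families of maps and integral curves in charts. -/

section ChartRepresentation

open Filter

variable {n : ℕ} {M : Type*} [TopologicalSpace M] [ChartedSpace (Model n) M]

/-- The coordinate representation of a family of maps in the preferred charts at `x₁` and `x₂`. -/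
noncomputable def chartRep (x₁ x₂ : M) (T : ℝ → M → M) (q : ℝ × Model n) : Model n :=
  extChartAt (𝓡 (2 * n + 1)) x₂ (T q.1 ((extChartAt (𝓡 (2 * n + 1)) x₁).symm q.2))

theorem tendsto_prodMk_extChartAt_symm (s : ℝ) (x : M) :
    Tendsto (fun q : ℝ × Model n => (q.1, (extChartAt (𝓡 (2 * n + 1)) x).symm q.2))
      (𝓝 (s, extChartAt (𝓡 (2 * n + 1)) x x)) (𝓝 (s, x)) := by
  refine Tendsto.prodMk_nhds (continuous_fst.tendsto' _ _ rfl) ?_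
  have h := continuousAt_extChartAt_symm (I := 𝓡 (2 * n + 1)) x
  rw [ContinuousAt, extChartAt_to_inv] at h
  exact h.comp (continuous_snd.tendsto' _ _ rfl)

theorem chartRep_self (x₁ x₂ : M) (T : ℝ → M → M) (s : ℝ) :
    chartRep x₁ x₂ T (s, extChartAt (𝓡 (2 * n + 1)) x₁ x₁) =
      extChartAt (𝓡 (2 * n + 1)) x₂ (T s x₁) := by
  simp [chartRep]

theorem LocalFlow.isOpen_slice {Y : ∀ x : M, TangentSpace (𝓡 (2 * n + 1)) x} (F : LocalFlow Y)
    (x : M) : IsOpen {t | (t, x) ∈ F.dom} :=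
  F.isOpen_dom.preimage (by fun_prop)

theorem LocalFlow.hasMFDerivAt {Y : ∀ x : M, TangentSpace (𝓡 (2 * n + 1)) x} (F : LocalFlow Y)
    {t : ℝ} {x : M} (h : (t, x) ∈ F.dom) :
    HasMFDerivAt 𝓘(ℝ, ℝ) (𝓡 (2 * n + 1)) (fun t => F.toFun t x) t
      ((1 : ℝ →L[ℝ] ℝ).smulRight (Y (F.toFun t x))) :=
  (F.integralCurve x t h).hasMFDerivAt ((F.isOpen_slice x).mem_nhds h)

theorem LocalFlow.contMDiffAt {Y : ∀ x : M, TangentSpace (𝓡 (2 * n + 1)) x} (F : LocalFlow Y)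
    {p : ℝ × M} (h : p ∈ F.dom) :
    ContMDiffAt (𝓘(ℝ, ℝ).prod (𝓡 (2 * n + 1))) (𝓡 (2 * n + 1)) ∞
      (fun p : ℝ × M => F.toFun p.1 p.2) p :=
  F.smooth.contMDiffAt (F.isOpen_dom.mem_nhds h)

variable [IsManifold (𝓡 (2 * n + 1)) ∞ M]

theorem contDiffAt_chartRep {x₁ x₂ : M} {T : ℝ → M → M} {s : ℝ}
    (hT : ContMDiffAt (𝓘(ℝ, ℝ).prod (𝓡 (2 * n + 1))) (𝓡 (2 * n + 1)) ∞
      (fun p : ℝ × M => T p.1 p.2) (s, x₁))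
    (hx₂ : T s x₁ ∈ (extChartAt (𝓡 (2 * n + 1)) x₂).source) :
    ContDiffAt ℝ ∞ (chartRep x₁ x₂ T) (s, extChartAt (𝓡 (2 * n + 1)) x₁ x₁) := by
  rw [← contMDiffAt_iff_contDiffAt]
  have hsymm : ContMDiffAt 𝓘(ℝ, Model n) (𝓡 (2 * n + 1)) ∞ (extChartAt (𝓡 (2 * n + 1)) x₁).symm
      (extChartAt (𝓡 (2 * n + 1)) x₁ x₁) :=
    (contMDiffOn_extChartAt_symm x₁).contMDiffAt (extChartAt_target_mem_nhds x₁)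
  have h1 : ContMDiffAt 𝓘(ℝ, ℝ × Model n) (𝓘(ℝ, ℝ).prod (𝓡 (2 * n + 1))) ∞
      (fun q : ℝ × Model n => (q.1, (extChartAt (𝓡 (2 * n + 1)) x₁).symm q.2))
      (s, extChartAt (𝓡 (2 * n + 1)) x₁ x₁) :=
    contDiffAt_fst.contMDiffAt.prodMk (hsymm.comp
      (f := fun q : ℝ × Model n => q.2) (s, extChartAt (𝓡 (2 * n + 1)) x₁ x₁)
      contDiffAt_snd.contMDiffAt)
  have h2 : ContMDiffAt 𝓘(ℝ, ℝ × Model n) (𝓡 (2 * n + 1)) ∞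
      (fun q : ℝ × Model n => T q.1 ((extChartAt (𝓡 (2 * n + 1)) x₁).symm q.2))
      (s, extChartAt (𝓡 (2 * n + 1)) x₁ x₁) :=
    ContMDiffAt.comp (g := fun p : ℝ × M => T p.1 p.2) _ (by simpa using hT) h1
  refine ContMDiffAt.comp (g := extChartAt (𝓡 (2 * n + 1)) x₂) _ ?_ h2
  refine (contMDiffOn_extChartAt (I := 𝓡 (2 * n + 1)) (x := x₂) (n := ∞)).contMDiffAt ?_
  rw [← extChartAt_source (𝓡 (2 * n + 1))]
  exact (isOpen_extChartAt_source x₂).mem_nhds (by simpa using hx₂)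

/-- Integral curves in a chart. -/
theorem hasDerivAt_extChartAt_of_isMIntegralCurveAt {Y : ∀ x : M, TangentSpace (𝓡 (2 * n + 1)) x}
    {γ : ℝ → M} {s : ℝ} {x₂ : M}
    (hγ : HasMFDerivAt 𝓘(ℝ, ℝ) (𝓡 (2 * n + 1)) γ s ((1 : ℝ →L[ℝ] ℝ).smulRight (Y (γ s))))
    (hs : γ s ∈ (extChartAt (𝓡 (2 * n + 1)) x₂).source) :
    HasDerivAt (fun t => extChartAt (𝓡 (2 * n + 1)) x₂ (γ t))
      (fieldRep Y x₂ (extChartAt (𝓡 (2 * n + 1)) x₂ (γ s))) s := by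
  have : IsManifold (𝓡 (2 * n + 1)) 1 M := .of_le (n := ∞) (by exact_mod_cast le_top)
  have hs' : γ s ∈ (chartAt (Model n) x₂).source := by
    rwa [extChartAt_source] at hs
  have h1 := (mdifferentiableAt_extChartAt (I := 𝓡 (2 * n + 1)) hs').hasMFDerivAt.comp s hγ
  have h2 := (show HasFDerivAt (fun t => extChartAt (𝓡 (2 * n + 1)) x₂ (γ t))
    (_ : ℝ →L[ℝ] Model n) s from hasMFDerivAt_iff_hasFDerivAt.1 h1).hasDerivAt
  refine h2.congr_deriv ?_
  have h3 : ∀ z, z = γ s → (mfderiv (𝓡 (2 * n + 1)) 𝓘(ℝ, Model n)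
      (extChartAt (𝓡 (2 * n + 1)) x₂) (γ s) (Y (γ s)) : Model n) =
      mfderiv (𝓡 (2 * n + 1)) 𝓘(ℝ, Model n) (extChartAt (𝓡 (2 * n + 1)) x₂) z (Y z) := by
    rintro _ rfl; rfl
  refine Eq.trans ?_ (h3 _ ((extChartAt (𝓡 (2 * n + 1)) x₂).left_inv hs))
  exact congrArg (mfderiv (𝓡 (2 * n + 1)) 𝓘(ℝ, Model n) (extChartAt (𝓡 (2 * n + 1)) x₂) (γ s))
    (one_smul ℝ (Y (γ s)))

theorem LocalFlow.eventually_hasDerivAt_chartRep {Y : ∀ x : M, TangentSpace (𝓡 (2 * n + 1)) x}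
    (F : LocalFlow Y) {s : ℝ} {x₁ x₂ : M} (h : (s, x₁) ∈ F.dom)
    (hx₂ : F.toFun s x₁ ∈ (extChartAt (𝓡 (2 * n + 1)) x₂).source) :
    ∀ᶠ q in 𝓝 (s, extChartAt (𝓡 (2 * n + 1)) x₁ x₁),
      HasDerivAt (fun t => chartRep x₁ x₂ F.toFun (t, q.2))
        (fieldRep Y x₂ (chartRep x₁ x₂ F.toFun q)) q.1 := by
  have h1 : ∀ᶠ p in 𝓝 (s, x₁), p ∈ F.dom ∧
      F.toFun p.1 p.2 ∈ (extChartAt (𝓡 (2 * n + 1)) x₂).source :=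
    (F.isOpen_dom.eventually_mem h).and ((F.contMDiffAt h).continuousAt.eventually_mem
      ((isOpen_extChartAt_source x₂).mem_nhds hx₂))
  filter_upwards [(tendsto_prodMk_extChartAt_symm s x₁).eventually h1] with q hq
  exact hasDerivAt_extChartAt_of_isMIntegralCurveAt (F.hasMFDerivAt hq.1) hq.2

end ChartRepresentation

/-! ### Contact maps, and flows of contact Hamiltonian fields. -/

section ContactFlows

open Filter

variable {n : ℕ} {M : Type*} [TopologicalSpace M] [ChartedSpace (Model n) M]

theorem IsContactForm.exists_apply_ne_zero {η : ∀ x : M, TangentSpace (𝓡 (2 * n + 1)) x →L[ℝ] ℝ}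
    (hη : IsContactForm η) (x : M) : ∃ v : Model n, η x v ≠ 0 := by
  by_contra! h
  obtain ⟨v, hv⟩ := hη.nondegenerate x
  refine hv (Finset.sum_eq_zero fun σ _ => ?_)
  rw [show η x (v (σ 0)) = 0 from h _, zero_mul, mul_zero]

theorem IsContactMap.refl (η : ∀ x : M, TangentSpace (𝓡 (2 * n + 1)) x →L[ℝ] ℝ) :
    IsContactMap η (OpenPartialHomeomorph.refl M) := by
  refine ⟨contMDiffOn_id, contMDiffOn_id, fun _ => 1, fun x _ => ⟨one_ne_zero, fun v => ?_⟩⟩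
  have h : mfderiv (𝓡 (2 * n + 1)) (𝓡 (2 * n + 1)) (OpenPartialHomeomorph.refl M) x =
      ContinuousLinearMap.id ℝ (TangentSpace (𝓡 (2 * n + 1)) x) := mfderiv_id
  rw [one_mul]
  exact congrArg (η x) (DFunLike.congr_fun h v)

theorem IsContactMap.trans {η : ∀ x : M, TangentSpace (𝓡 (2 * n + 1)) x →L[ℝ] ℝ}
    {f g : OpenPartialHomeomorph M M} (hf : IsContactMap η f) (hg : IsContactMap η g) :
    IsContactMap η (f.trans g) := by
  obtain ⟨r, hr⟩ := hf.pullback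
  obtain ⟨r', hr'⟩ := hg.pullback
  refine ⟨?_, ?_, fun x => r' (f x) * r x, ?_⟩
  · rw [OpenPartialHomeomorph.trans_source]
    exact hg.smooth.comp (hf.smooth.mono Set.inter_subset_left) Set.inter_subset_right
  · rw [OpenPartialHomeomorph.trans_target]
    exact hf.smooth_symm.comp (hg.smooth_symm.mono Set.inter_subset_left) Set.inter_subset_right
  · intro x hx
    rw [OpenPartialHomeomorph.trans_source] at hx
    obtain ⟨h1, h2⟩ := hr x hx.1
    obtain ⟨h3, h4⟩ := hr' (f x) hx.2
    refine ⟨mul_ne_zero h3 h1, fun v => ?_⟩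
    have df := (hf.smooth.contMDiffAt (f.open_source.mem_nhds hx.1)).mdifferentiableAt
      (by simp : (∞ : ℕ∞ω) ≠ 0)
    have dg := (hg.smooth.contMDiffAt (g.open_source.mem_nhds hx.2)).mdifferentiableAt
      (by simp : (∞ : ℕ∞ω) ≠ 0)
    have hc := DFunLike.congr_fun (mfderiv_comp x dg df) v
    calc η ((f.trans g) x) (mfderiv (𝓡 (2 * n + 1)) (𝓡 (2 * n + 1)) (f.trans g) x v)
        = η (g (f x)) (mfderiv (𝓡 (2 * n + 1)) (𝓡 (2 * n + 1)) g (f x)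
            (mfderiv (𝓡 (2 * n + 1)) (𝓡 (2 * n + 1)) f x v)) := congrArg (η (g (f x))) hc
      _ = r' (f x) * r x * η x v := by rw [h4, h2, mul_assoc]

theorem LocalFlow.contMDiffOn_exp {Y : ∀ x : M, TangentSpace (𝓡 (2 * n + 1)) x} (F : LocalFlow Y)
    (t : ℝ) : ContMDiffOn (𝓡 (2 * n + 1)) (𝓡 (2 * n + 1)) ∞ (F.toFun t) {x | (t, x) ∈ F.dom} :=
  F.smooth.comp (f := fun x => (t, x)) (contMDiff_const.prodMk contMDiff_id).contMDiffOn
    fun _ hx => hx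

variable [IsManifold (𝓡 (2 * n + 1)) ∞ M]

theorem formRep_apply_mfderiv (η : ∀ x : M, TangentSpace (𝓡 (2 * n + 1)) x →L[ℝ] ℝ) (x₀ : M)
    {z : M} (hz : z ∈ (extChartAt (𝓡 (2 * n + 1)) x₀).source)
    (w : TangentSpace (𝓡 (2 * n + 1)) z) :
    formRep η x₀ (extChartAt (𝓡 (2 * n + 1)) x₀ z)
      (mfderiv (𝓡 (2 * n + 1)) 𝓘(ℝ, Model n) (extChartAt (𝓡 (2 * n + 1)) x₀) z w) = η z w := by
  have : IsManifold (𝓡 (2 * n + 1)) 1 M := .of_le (n := ∞) (by exact_mod_cast le_top)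
  have h := mfderivWithin_extChartAt_symm_comp_mfderiv_extChartAt' (I := 𝓡 (2 * n + 1)) hz
  rw [ModelWithCorners.range_eq_univ, mfderivWithin_univ] at h
  have h1 : (mfderiv 𝓘(ℝ, Model n) (𝓡 (2 * n + 1)) (extChartAt (𝓡 (2 * n + 1)) x₀).symm
    (extChartAt (𝓡 (2 * n + 1)) x₀ z) (mfderiv (𝓡 (2 * n + 1)) 𝓘(ℝ, Model n)
      (extChartAt (𝓡 (2 * n + 1)) x₀) z w) : Model n) = w := DFunLike.congr_fun h w
  have h2 : ∀ z', z' = z → η z' w = η z w := by rintro _ rfl; rfl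
  exact (congrArg (η _) h1).trans (h2 _ ((extChartAt (𝓡 (2 * n + 1)) x₀).left_inv hz))

/-- The spatial derivative of the coordinate representation of a family of maps. -/
theorem fderiv_chartRep {x₁ x₂ : M} {T : ℝ → M → M} {s : ℝ}
    (hT : ContMDiffAt (𝓘(ℝ, ℝ).prod (𝓡 (2 * n + 1))) (𝓡 (2 * n + 1)) ∞
      (fun p : ℝ × M => T p.1 p.2) (s, x₁))
    (hx₂ : T s x₁ ∈ (extChartAt (𝓡 (2 * n + 1)) x₂).source) (v : Model n) :
    fderiv ℝ (chartRep x₁ x₂ T) (s, extChartAt (𝓡 (2 * n + 1)) x₁ x₁) (0, v) =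
      mfderiv (𝓡 (2 * n + 1)) 𝓘(ℝ, Model n) (extChartAt (𝓡 (2 * n + 1)) x₂) (T s x₁)
        (mfderiv (𝓡 (2 * n + 1)) (𝓡 (2 * n + 1)) (T s) x₁ v) := by
  have : IsManifold (𝓡 (2 * n + 1)) 1 M := .of_le (n := ∞) (by exact_mod_cast le_top)
  have hd : DifferentiableAt ℝ (chartRep x₁ x₂ T) (s, extChartAt (𝓡 (2 * n + 1)) x₁ x₁) :=
    (contDiffAt_chartRep hT hx₂).differentiableAt (by simp)
  have h1 : HasFDerivAt (fun y => chartRep x₁ x₂ T (s, y))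
      ((fderiv ℝ (chartRep x₁ x₂ T) (s, extChartAt (𝓡 (2 * n + 1)) x₁ x₁)).comp
        (ContinuousLinearMap.inr ℝ ℝ (Model n))) (extChartAt (𝓡 (2 * n + 1)) x₁ x₁) :=
    hd.hasFDerivAt.comp _ (hasFDerivAt_prodMk_right s _)
  have hTs : MDifferentiableAt (𝓡 (2 * n + 1)) (𝓡 (2 * n + 1)) (T s) x₁ :=
    (ContMDiffAt.comp (g := fun p : ℝ × M => T p.1 p.2) (f := fun x => (s, x)) x₁ hT
      (contMDiffAt_const.prodMk contMDiffAt_id)).mdifferentiableAt (by simp)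
  have hsymm : HasMFDerivAt 𝓘(ℝ, Model n) (𝓡 (2 * n + 1)) (extChartAt (𝓡 (2 * n + 1)) x₁).symm
      (extChartAt (𝓡 (2 * n + 1)) x₁ x₁) (ContinuousLinearMap.id ℝ (Model n)) := by
    have h2 := ((mdifferentiableWithinAt_extChartAt_symm (I := 𝓡 (2 * n + 1))
      (mem_extChartAt_target x₁)).hasMFDerivWithinAt).hasMFDerivAt
        (by rw [ModelWithCorners.range_eq_univ]; exact Filter.univ_mem)
    exact h2.congr_mfderiv (mfderivWithin_range_extChartAt_symm (I := 𝓡 (2 * n + 1)))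
  have hx₂' : T s x₁ ∈ (chartAt (Model n) x₂).source := by rwa [extChartAt_source] at hx₂
  have hchart := (mdifferentiableAt_extChartAt (I := 𝓡 (2 * n + 1)) hx₂').hasMFDerivAt
  have htr : ∀ (g : M → Model n) (L : Model n →L[ℝ] Model n) (z : M), z = x₁ →
      HasMFDerivAt (𝓡 (2 * n + 1)) 𝓘(ℝ, Model n) g x₁ L →
      HasMFDerivAt (𝓡 (2 * n + 1)) 𝓘(ℝ, Model n) g z L := by rintro g L _ rfl hL; exact hL
  let L : Model n →L[ℝ] Model n :=
    (mfderiv (𝓡 (2 * n + 1)) 𝓘(ℝ, Model n) (extChartAt (𝓡 (2 * n + 1)) x₂) (T s x₁)).comp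
      (mfderiv (𝓡 (2 * n + 1)) (𝓡 (2 * n + 1)) (T s) x₁)
  have h3 : HasFDerivAt (fun y => chartRep x₁ x₂ T (s, y))
      (L.comp (ContinuousLinearMap.id ℝ (Model n))) (extChartAt (𝓡 (2 * n + 1)) x₁ x₁) :=
    hasMFDerivAt_iff_hasFDerivAt.1
      (HasMFDerivAt.comp (g := extChartAt (𝓡 (2 * n + 1)) x₂ ∘ T s) _
        (htr _ L _ (extChartAt_to_inv x₁) (hchart.comp x₁ hTs.hasMFDerivAt)) hsymm)
  exact (DFunLike.congr_fun (h3.unique h1) v).symm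

/-- The derivative of the pullback of `η` along the flow of `Y` is the pullback of `£_Y η`. -/
theorem LocalFlow.hasDerivAt_pullback {η : ∀ x : M, TangentSpace (𝓡 (2 * n + 1)) x →L[ℝ] ℝ}
    (hη : IsSmoothForm η) {Y : ∀ x : M, TangentSpace (𝓡 (2 * n + 1)) x} (hY : IsSmoothField Y)
    (F : LocalFlow Y) {s : ℝ} {x : M} (h : (s, x) ∈ F.dom) (v : Model n) :
    HasDerivAt (fun t => η (F.toFun t x)
        (mfderiv (𝓡 (2 * n + 1)) (𝓡 (2 * n + 1)) (F.toFun t) x v))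
      (lieDer Y η (F.toFun s x) (mfderiv (𝓡 (2 * n + 1)) (𝓡 (2 * n + 1)) (F.toFun s) x v)) s := by
  -- The target chart is the preferred one at the image point, since `lieDer` at `p` is defined
  -- through it.
  set p := F.toFun s x with hp
  have hps : p ∈ (extChartAt (𝓡 (2 * n + 1)) p).source := mem_extChartAt_source p
  set y₀ := extChartAt (𝓡 (2 * n + 1)) x x with hy₀
  set f : ℝ × Model n → Model n := chartRep x p F.toFun with hf
  have hfs : f (s, y₀) = extChartAt (𝓡 (2 * n + 1)) p p := chartRep_self x p F.toFun s
  have hfd : ContDiffAt ℝ ∞ f (s, y₀) := contDiffAt_chartRep (F.contMDiffAt h) hps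
  have hflow : ∀ᶠ q in 𝓝 (s, y₀), fderiv ℝ f q (1, 0) = fieldRep Y p (f q) := by
    have hd : ∀ᶠ q in 𝓝 (s, y₀), DifferentiableAt ℝ f q := by
      filter_upwards [(hfd.of_le (show (1 : ℕ∞ω) ≤ ∞ by exact_mod_cast le_top)).eventually
        (by simp)] with q hq using hq.differentiableAt one_ne_zero
    filter_upwards [hd, F.eventually_hasDerivAt_chartRep h hps] with q h1 h2
    have h3 : HasDerivAt (fun t => f (t, q.2)) (fderiv ℝ f q (1, 0)) q.1 :=
      HasFDerivAt.comp_hasDerivAt (f := fun t => (t, q.2)) q.1 h1.hasFDerivAt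
        ((hasDerivAt_id q.1).prodMk (hasDerivAt_const _ _))
    exact h3.unique h2
  have key := ContactIntegrator.hasDerivAt_pullback (f := f) (X := fieldRep Y p)
    (θ := formRep η p) (hfd.of_le (WithTop.coe_le_coe.2 (le_top : (2 : ℕ∞) ≤ ⊤)))
    (by rw [hfs]; exact differentiableAt_fieldRep hY p)
    (by rw [hfs]; exact differentiableAt_formRep hη p) hflow v
  rw [hfs, ← lieDer_apply] at key
  have hW : fderiv ℝ f (s, y₀) (0, v) =
      mfderiv (𝓡 (2 * n + 1)) (𝓡 (2 * n + 1)) (F.toFun s) x v := by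
    have : IsManifold (𝓡 (2 * n + 1)) 1 M := .of_le (n := ∞) (by exact_mod_cast le_top)
    rw [fderiv_chartRep (F.contMDiffAt h) hps]
    exact vecRep_apply p (mfderiv (𝓡 (2 * n + 1)) (𝓡 (2 * n + 1)) (F.toFun s) x v)
  rw [hW] at key
  refine key.congr_of_eventuallyEq ?_
  have hcont : ContinuousAt (fun t => F.toFun t x) s := (F.hasMFDerivAt h).continuousAt
  filter_upwards [(F.isOpen_slice x).mem_nhds h,
    hcont.eventually_mem ((isOpen_extChartAt_source p).mem_nhds hps)] with t ht hts
  rw [show f (t, y₀) = extChartAt (𝓡 (2 * n + 1)) p (F.toFun t x) from chartRep_self x p F.toFun t,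
    fderiv_chartRep (F.contMDiffAt ht) hts]
  exact (formRep_apply_mfderiv η p hts _).symm

/-- The flow of a contact Hamiltonian vector field consists of contact transformations. -/
theorem LocalFlow.isContactMap_exp {η : ∀ x : M, TangentSpace (𝓡 (2 * n + 1)) x →L[ℝ] ℝ}
    (hη : IsContactForm η) {H : M → ℝ} {Y : ∀ x : M, TangentSpace (𝓡 (2 * n + 1)) x}
    (hY : IsContactHamiltonianField η H Y) (F : LocalFlow Y) (t : ℝ) :
    IsContactMap η (F.exp t) := by
  have hmd : ∀ s, (F.exp s).MDifferentiable (𝓡 (2 * n + 1)) (𝓡 (2 * n + 1)) := fun s =>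
    ⟨(F.contMDiffOn_exp s).mdifferentiableOn (by simp),
      (F.contMDiffOn_exp (-s)).mdifferentiableOn (by simp)⟩
  refine ⟨F.contMDiffOn_exp t, F.contMDiffOn_exp (-t), ?_⟩
  obtain ⟨ρ, hρ⟩ := hY.lieDer_eq
  suffices H : ∀ x : M, (t, x) ∈ F.dom → ∃ r : ℝ, r ≠ 0 ∧ ∀ v : Model n, η (F.toFun t x)
      (mfderiv (𝓡 (2 * n + 1)) (𝓡 (2 * n + 1)) (F.toFun t) x v) = r * η x v by
    choose! r hr using H
    exact ⟨r, hr⟩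
  intro x hx
  let g : Model n → ℝ → ℝ := fun v s => η (F.toFun s x)
    (mfderiv (𝓡 (2 * n + 1)) (𝓡 (2 * n + 1)) (F.toFun s) x v)
  -- The derivative of a flow map is surjective, so the pullback of the nowhere zero form `η` is
  -- nonzero.
  have hsurj : ∀ s, (s, x) ∈ F.dom → ∃ w, g w s ≠ 0 := by
    intro s hs
    obtain ⟨u, hu⟩ := hη.exists_apply_ne_zero (F.toFun s x)
    obtain ⟨w, hw⟩ := (hmd s).mfderiv_surjective (x := x) hs u
    exact ⟨w, by rwa [← hw] at hu⟩
  have hg : ∀ v, ∀ s ∈ {s | (s, x) ∈ F.dom}, HasDerivAt (g v) (ρ (F.toFun s x) * g v s) s := by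
    intro v s hs
    have := F.hasDerivAt_pullback hη.smooth hY.smooth hs v
    rwa [hρ] at this
  have hg0 : ∀ v, g v 0 = η x v := by
    intro v
    have h0 : F.toFun 0 = id := funext F.map_zero
    have h1 : ∀ f : M → M, f = id → η (f x) (mfderiv (𝓡 (2 * n + 1)) (𝓡 (2 * n + 1)) f x v)
        = η x v := by
      rintro _ rfl
      rw [mfderiv_id]; rfl
    exact h1 _ h0
  have hker : ∀ v, η x v = 0 → g v t = 0 := fun v hv =>
    eq_zero_of_hasDerivAt_mul (F.isOpen_slice x) (F.ordConnected x).isPreconnected hg hsurj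
      (F.zero_mem x) ((hg0 v).trans hv) t hx
  obtain ⟨e, he⟩ := hη.exists_apply_ne_zero x
  have hadd : ∀ (a : ℝ) (v w : Model n), g (v + a • w) t = g v t + a * g w t := by
    intro a v w
    let A : Model n →L[ℝ] ℝ := (η (F.toFun t x)).comp
      (mfderiv (𝓡 (2 * n + 1)) (𝓡 (2 * n + 1)) (F.toFun t) x)
    change A (v + a • w) = A v + a * A w
    rw [map_add, map_smul, smul_eq_mul]
  have hη_add : ∀ (a : ℝ) (v w : Model n), η x (v + a • w) = η x v + a * η x w := by
    intro a v w
    let A : Model n →L[ℝ] ℝ := η x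
    change A (v + a • w) = A v + a * A w
    rw [map_add, map_smul, smul_eq_mul]
  -- A linear functional vanishing on the kernel of `η x` is a multiple of it: apply `hker` to `v -
  -- (η(v)/η(e)) e`.
  have hlin : ∀ v, g v t = g e t / η x e * η x v := by
    intro v
    have h1 := hker (v + (-(η x v / η x e)) • e) (by
      rw [hη_add]; field_simp; ring)
    rw [hadd] at h1
    field_simp
    field_simp at h1
    linarith
  refine ⟨g e t / η x e, fun h0 => ?_, hlin⟩
  obtain ⟨w, hw⟩ := hsurj t hx
  exact hw (by rw [hlin, h0, zero_mul])

end ContactFlows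

/-! ### Smooth families of local maps on the manifold, and transfer of the order from charts. -/

section Families

open Filter

/-- The initial velocity of a composition is the sum of the initial velocities. -/
theorem IsSmoothFamilyNear.hasDerivAt_comp {E : Type*} [NormedAddCommGroup E] [NormedSpace ℝ E]
    {s t : ℝ × E → E} {y₀ : E} {V W : E → E} (hs : IsSmoothFamilyNear y₀ s)
    (ht : IsSmoothFamilyNear y₀ t) (hV : ∀ᶠ y in 𝓝 y₀, HasDerivAt (fun τ => s (τ, y)) (V y) 0)
    (hW : ∀ᶠ y in 𝓝 y₀, HasDerivAt (fun τ => t (τ, y)) (W y) 0) :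
    ∀ᶠ y in 𝓝 y₀, HasDerivAt (fun τ => t (τ, s (τ, y))) (V y + W y) 0 := by
  have hd : ∀ᶠ q in 𝓝 ((0 : ℝ), y₀), DifferentiableAt ℝ t q := by
    filter_upwards [(ht.contDiffAt.of_le (show (1 : ℕ∞ω) ≤ ∞ by exact_mod_cast le_top)).eventually
      (by simp)] with q hq using hq.differentiableAt one_ne_zero
  have t0 : Tendsto (fun y : E => ((0 : ℝ), y)) (𝓝 y₀) (𝓝 (0, y₀)) :=
    (by fun_prop : Continuous fun y : E => ((0 : ℝ), y)).tendsto' _ _ rfl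
  filter_upwards [hV, hW, t0.eventually hd, hs.eventually_zero,
    eventually_eventually_nhds.2 ht.eventually_zero] with y hVy hWy hdy hsy hty
  have e1 : fderiv ℝ t (0, y) (1, 0) = W y := by
    have : HasDerivAt (fun τ => t (τ, y)) (fderiv ℝ t (0, y) (1, 0)) 0 :=
      HasFDerivAt.comp_hasDerivAt (f := fun τ : ℝ => (τ, y)) 0 hdy.hasFDerivAt
        ((hasDerivAt_id (0 : ℝ)).prodMk (hasDerivAt_const _ _))
    exact this.unique hWy
  -- Near `y` the map `t (0, ·)` is the identity, and so is its derivative.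
  have e2 : fderiv ℝ t (0, y) (0, V y) = V y := by
    have h1 : HasFDerivAt (fun z => t (0, z))
        ((fderiv ℝ t (0, y)).comp (ContinuousLinearMap.inr ℝ ℝ E)) y :=
      hdy.hasFDerivAt.comp y (hasFDerivAt_prodMk_right (0 : ℝ) y)
    have h2 := h1.unique ((hasFDerivAt_id y).congr_of_eventuallyEq hty)
    exact DFunLike.congr_fun h2 (V y)
  have h3 : HasDerivAt (fun τ => t (τ, s (τ, y))) (fderiv ℝ t (0, y) (1, V y)) 0 :=
    HasFDerivAt.comp_hasDerivAt_of_eq (f := fun τ : ℝ => (τ, s (τ, y))) 0 hdy.hasFDerivAt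
      ((hasDerivAt_id (0 : ℝ)).prodMk hVy) (by simp [hsy])
  refine h3.congr_deriv ?_
  have h4 : ((1 : ℝ), V y) = (1, 0) + (0, V y) := by simp
  rw [h4, map_add, e1, e2, add_comm]

variable {n : ℕ} {M : Type*} [TopologicalSpace M] [ChartedSpace (Model n) M]

/-- `S` is, near `x₀`, a smooth family of local transformations with `S 0 = id`; in the preferred
chart at `x₀`, its initial velocity is `V`. -/
structure IsFamilyAt (S : ℝ → OpenPartialHomeomorph M M) (x₀ : M) (V : Model n → Model n) :
    Prop where
  eventually_mem : ∀ᶠ p in 𝓝 ((0 : ℝ), x₀), p.2 ∈ (S p.1).source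
  contMDiffAt : ContMDiffAt (𝓘(ℝ, ℝ).prod (𝓡 (2 * n + 1))) (𝓡 (2 * n + 1)) ∞
    (fun p : ℝ × M => S p.1 p.2) (0, x₀)
  eventually_zero : ∀ᶠ x in 𝓝 x₀, S 0 x = x
  eventually_hasDerivAt : ∀ᶠ y in 𝓝 (extChartAt (𝓡 (2 * n + 1)) x₀ x₀),
    HasDerivAt (fun τ => chartRep x₀ x₀ (fun τ => S τ) (τ, y)) (V y) 0

theorem tendsto_prodMk_extChartAt (x₀ : M) :
    Tendsto (fun p : ℝ × M => (p.1, extChartAt (𝓡 (2 * n + 1)) x₀ p.2)) (𝓝 (0, x₀))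
      (𝓝 (0, extChartAt (𝓡 (2 * n + 1)) x₀ x₀)) :=
  (continuous_fst.tendsto' _ _ rfl).prodMk_nhds
    ((continuousAt_extChartAt x₀).tendsto.comp (continuous_snd.tendsto' _ _ rfl))

namespace IsFamilyAt

variable {S T : ℝ → OpenPartialHomeomorph M M} {x₀ : M} {V W : Model n → Model n}

theorem zero (h : IsFamilyAt S x₀ V) : S 0 x₀ = x₀ := h.eventually_zero.self_of_nhds

theorem tendsto (h : IsFamilyAt S x₀ V) :
    Tendsto (fun p : ℝ × M => S p.1 p.2) (𝓝 (0, x₀)) (𝓝 x₀) := by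
  have := h.contMDiffAt.continuousAt
  rwa [ContinuousAt, h.zero] at this

theorem eventually_mem_source (h : IsFamilyAt S x₀ V) :
    ∀ᶠ p in 𝓝 ((0 : ℝ), x₀), S p.1 p.2 ∈ (extChartAt (𝓡 (2 * n + 1)) x₀).source :=
  h.tendsto.eventually_mem (extChartAt_source_mem_nhds x₀)

theorem chartRep_trans (hS : IsFamilyAt S x₀ V) (T : ℝ → OpenPartialHomeomorph M M) :
    chartRep x₀ x₀ (fun τ => (S τ).trans (T τ)) =ᶠ[𝓝 (0, extChartAt (𝓡 (2 * n + 1)) x₀ x₀)]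
      fun q => chartRep x₀ x₀ (fun τ => T τ) (q.1, chartRep x₀ x₀ (fun τ => S τ) q) := by
  filter_upwards [(tendsto_prodMk_extChartAt_symm 0 x₀).eventually hS.eventually_mem_source]
    with q hq
  simp only [chartRep]
  rw [(extChartAt (𝓡 (2 * n + 1)) x₀).left_inv hq]
  rfl

theorem isSymmetricNear (hS : IsFamilyAt S x₀ V) (h : ∀ τ, S (-τ) = (S τ).symm) :
    IsSymmetricNear (extChartAt (𝓡 (2 * n + 1)) x₀ x₀) (chartRep x₀ x₀ fun τ => S τ) := by
  have htgt : ∀ᶠ q in 𝓝 ((0 : ℝ), extChartAt (𝓡 (2 * n + 1)) x₀ x₀),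
      q.2 ∈ (extChartAt (𝓡 (2 * n + 1)) x₀).target :=
    (continuous_snd.tendsto' ((0 : ℝ), extChartAt (𝓡 (2 * n + 1)) x₀ x₀)
      (extChartAt (𝓡 (2 * n + 1)) x₀ x₀) rfl).eventually_mem
      (extChartAt_target_mem_nhds x₀)
  filter_upwards [(tendsto_prodMk_extChartAt_symm 0 x₀).eventually hS.eventually_mem_source,
    (tendsto_prodMk_extChartAt_symm 0 x₀).eventually hS.eventually_mem, htgt] with q h1 h2 h3
  simp only [chartRep]
  rw [(extChartAt (𝓡 (2 * n + 1)) x₀).left_inv h1, h, (S q.1).left_inv h2,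
    (extChartAt (𝓡 (2 * n + 1)) x₀).right_inv h3]

theorem scale (hS : IsFamilyAt S x₀ V) (r : ℝ) :
    IsFamilyAt (fun τ => S (r * τ)) x₀ fun y => r • V y := by
  have t := tendsto_scale r x₀
  refine ⟨t.eventually hS.eventually_mem, ?_, by simpa using hS.eventually_zero, ?_⟩
  · refine ContMDiffAt.comp (g := fun p : ℝ × M => S p.1 p.2) (f := fun p : ℝ × M => (r * p.1, p.2))
      _ (by simpa using hS.contMDiffAt) ?_
    have h1 : ContMDiffAt (𝓘(ℝ, ℝ).prod (𝓡 (2 * n + 1))) 𝓘(ℝ, ℝ) ∞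
        (fun p : ℝ × M => r * p.1) (0, x₀) :=
      ContMDiffAt.comp (g := fun τ : ℝ => r * τ) (f := fun p : ℝ × M => p.1) _
        (by fun_prop : ContDiff ℝ ∞ fun τ : ℝ => r * τ).contMDiff.contMDiffAt contMDiffAt_fst
    exact h1.prodMk contMDiffAt_snd
  · filter_upwards [hS.eventually_hasDerivAt] with y hy
    have h1 : HasDerivAt (fun τ : ℝ => r * τ) r 0 := by
      simpa using (hasDerivAt_id (0 : ℝ)).const_mul r
    exact HasDerivAt.scomp_of_eq
      (g₁ := fun τ => chartRep x₀ x₀ (fun τ => S τ) (τ, y)) 0 hy h1 (by simp)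

theorem refl (x₀ : M) : IsFamilyAt (fun _ => OpenPartialHomeomorph.refl M) x₀
    (fun _ : Model n => 0) := by
  refine ⟨Eventually.of_forall fun _ => Set.mem_univ _, contMDiffAt_snd,
    Eventually.of_forall fun _ => rfl, Eventually.of_forall fun y => ?_⟩
  exact hasDerivAt_const (0 : ℝ)
    (extChartAt (𝓡 (2 * n + 1)) x₀ ((extChartAt (𝓡 (2 * n + 1)) x₀).symm y))

variable [IsManifold (𝓡 (2 * n + 1)) ∞ M]

theorem isSmoothFamilyNear (hS : IsFamilyAt S x₀ V) :
    IsSmoothFamilyNear (extChartAt (𝓡 (2 * n + 1)) x₀ x₀) (chartRep x₀ x₀ fun τ => S τ) := by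
  refine ⟨contDiffAt_chartRep hS.contMDiffAt ?_, ?_⟩
  · simp only [hS.zero]
    exact mem_extChartAt_source x₀
  · have h := continuousAt_extChartAt_symm (I := 𝓡 (2 * n + 1)) x₀
    rw [ContinuousAt, extChartAt_to_inv] at h
    filter_upwards [h.eventually hS.eventually_zero, extChartAt_target_mem_nhds x₀] with y h1 h2
    simp only [chartRep]
    rw [h1, (extChartAt (𝓡 (2 * n + 1)) x₀).right_inv h2]

theorem trans (hS : IsFamilyAt S x₀ V) (hT : IsFamilyAt T x₀ W) :
    IsFamilyAt (fun τ => (S τ).trans (T τ)) x₀ fun y => V y + W y := by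
  have t : Tendsto (fun p : ℝ × M => (p.1, S p.1 p.2)) (𝓝 (0, x₀)) (𝓝 (0, x₀)) :=
    (continuous_fst.tendsto' ((0 : ℝ), x₀) 0 rfl).prodMk_nhds hS.tendsto
  refine ⟨?_, ?_, ?_, ?_⟩
  · filter_upwards [hS.eventually_mem, t.eventually hT.eventually_mem] with p h1 h2
    rw [OpenPartialHomeomorph.trans_source]
    exact ⟨h1, h2⟩
  · exact ContMDiffAt.comp (g := fun p : ℝ × M => T p.1 p.2)
      (f := fun p : ℝ × M => (p.1, S p.1 p.2))
      _ (by simpa [hS.zero] using hT.contMDiffAt) (contMDiffAt_fst.prodMk hS.contMDiffAt)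
  · filter_upwards [hS.eventually_zero, hT.eventually_zero] with x h1 h2
    rw [OpenPartialHomeomorph.trans_apply, h1, h2]
  · have t0 : Tendsto (fun y : Model n => ((0 : ℝ), y)) (𝓝 (extChartAt (𝓡 (2 * n + 1)) x₀ x₀))
        (𝓝 (0, extChartAt (𝓡 (2 * n + 1)) x₀ x₀)) :=
      (by fun_prop : Continuous fun y : Model n => ((0 : ℝ), y)).tendsto' _ _ rfl
    filter_upwards [hS.isSmoothFamilyNear.hasDerivAt_comp hT.isSmoothFamilyNear
      hS.eventually_hasDerivAt hT.eventually_hasDerivAt,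
      t0.eventually (eventually_eventually_nhds.2 (hS.chartRep_trans T))] with y h1 h2
    refine h1.congr_of_eventuallyEq ?_
    have : Tendsto (fun τ : ℝ => (τ, y)) (𝓝 0) (𝓝 (0, y)) :=
      (by fun_prop : Continuous fun τ : ℝ => (τ, y)).tendsto' _ _ rfl
    exact this.eventually h2

theorem exp {Y : ∀ x : M, TangentSpace (𝓡 (2 * n + 1)) x} (F : LocalFlow Y) (x₀ : M) :
    IsFamilyAt F.exp x₀ (fieldRep Y x₀) := by
  have h0 := F.zero_mem x₀
  have hsrc : F.toFun 0 x₀ ∈ (extChartAt (𝓡 (2 * n + 1)) x₀).source := by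
    rw [F.map_zero]; exact mem_extChartAt_source x₀
  refine ⟨F.isOpen_dom.eventually_mem h0, F.contMDiffAt h0, Eventually.of_forall F.map_zero, ?_⟩
  have t0 : Tendsto (fun y : Model n => ((0 : ℝ), y)) (𝓝 (extChartAt (𝓡 (2 * n + 1)) x₀ x₀))
      (𝓝 (0, extChartAt (𝓡 (2 * n + 1)) x₀ x₀)) :=
    (by fun_prop : Continuous fun y : Model n => ((0 : ℝ), y)).tendsto' _ _ rfl
  filter_upwards [t0.eventually (F.eventually_hasDerivAt_chartRep h0 hsrc),
    extChartAt_target_mem_nhds x₀] with y h1 h2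
  have h3 : chartRep x₀ x₀ F.toFun (0, y) = y := by
    simp only [chartRep, F.map_zero]
    exact (extChartAt (𝓡 (2 * n + 1)) x₀).right_inv h2
  rw [h3] at h1
  exact h1

/-- Every flow except the innermost occurs twice with half the step, so each field enters the
initial velocity with total weight `1`. -/
theorem splitting (l : List ((ℝ → OpenPartialHomeomorph M M) × (Model n → Model n)))
    (hl : ∀ e ∈ l, IsFamilyAt e.1 x₀ e.2) :
    IsFamilyAt (splitting (l.map Prod.fst)) x₀ fun y => (l.map fun e => e.2 y).sum := by
  induction l with
  | nil => exact refl x₀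
  | cons e l ih =>
    cases l with
    | nil => simpa [ContactIntegrator.splitting] using hl e (by simp)
    | cons e' l =>
      have h1 := ih fun a ha => hl a (List.mem_cons_of_mem _ ha)
      have h2 := (hl e (by simp)).scale (1 / 2)
      have h3 := h2.trans (h1.trans h2)
      have h4 : ContactIntegrator.splitting ((e :: e' :: l).map Prod.fst) = fun τ =>
          (e.1 (1 / 2 * τ)).trans ((ContactIntegrator.splitting ((e' :: l).map Prod.fst) τ).trans
            (e.1 (1 / 2 * τ))) := by
        funext τ
        rw [show 1 / 2 * τ = τ / 2 by ring]
        rfl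
      rw [h4]
      convert h3 using 1
      funext y
      rw [List.map_cons, List.sum_cons]
      module

theorem tripleJump (hS : IsFamilyAt S x₀ V) (k : ℕ) :
    ∃ V' : Model n → Model n, IsFamilyAt (tripleJump S k) x₀ V' := by
  induction k with
  | zero => exact ⟨V, hS⟩
  | succ k ih =>
    obtain ⟨V', h⟩ := ih
    exact ⟨_, (h.scale _).trans ((h.scale _).trans (h.scale _))⟩

theorem chartRep_tripleJump_succ (hS : IsFamilyAt S x₀ V) (k : ℕ) :
    chartRep x₀ x₀ (fun τ => ContactIntegrator.tripleJump S (k + 1) τ)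
      =ᶠ[𝓝 (0, extChartAt (𝓡 (2 * n + 1)) x₀ x₀)]
      jump (z₁ (k + 1)) (z₀ (k + 1))
        (chartRep x₀ x₀ fun τ => ContactIntegrator.tripleJump S k τ) := by
  obtain ⟨V', h⟩ := hS.tripleJump k
  have h1 := (h.scale (z₁ (k + 1))).chartRep_trans fun τ =>
    (ContactIntegrator.tripleJump S k (z₀ (k + 1) * τ)).trans
      (ContactIntegrator.tripleJump S k (z₁ (k + 1) * τ))
  have h2 := (h.scale (z₀ (k + 1))).chartRep_trans fun τ =>
    ContactIntegrator.tripleJump S k (z₁ (k + 1) * τ)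
  have t : Tendsto (fun q : ℝ × Model n => (q.1, chartRep x₀ x₀
      (fun τ => ContactIntegrator.tripleJump S k (z₁ (k + 1) * τ)) q))
      (𝓝 (0, extChartAt (𝓡 (2 * n + 1)) x₀ x₀)) (𝓝 (0, extChartAt (𝓡 (2 * n + 1)) x₀ x₀)) :=
    (continuous_fst.tendsto' _ _ rfl).prodMk_nhds (h.scale (z₁ (k + 1))).isSmoothFamilyNear.tendsto
  filter_upwards [h1, t.eventually h2] with q e1 e2
  exact e1.trans e2

end IsFamilyAt

variable [IsManifold (𝓡 (2 * n + 1)) ∞ M]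

theorem hasMFDerivAt_extChartAt_symm_comp {X : ∀ x : M, TangentSpace (𝓡 (2 * n + 1)) x} {x₀ : M}
    {γ : ℝ → Model n} {t : ℝ} (hγ : HasDerivAt γ (fieldRep X x₀ (γ t)) t)
    (ht : γ t ∈ (extChartAt (𝓡 (2 * n + 1)) x₀).target) :
    HasMFDerivAt 𝓘(ℝ, ℝ) (𝓡 (2 * n + 1)) (fun t => (extChartAt (𝓡 (2 * n + 1)) x₀).symm (γ t)) t
      ((1 : ℝ →L[ℝ] ℝ).smulRight (X ((extChartAt (𝓡 (2 * n + 1)) x₀).symm (γ t)))) := by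
  have : IsManifold (𝓡 (2 * n + 1)) 1 M := .of_le (n := ∞) (by exact_mod_cast le_top)
  have h1 := ((mdifferentiableWithinAt_extChartAt_symm (I := 𝓡 (2 * n + 1))
    ht).hasMFDerivWithinAt).hasMFDerivAt
      (by rw [ModelWithCorners.range_eq_univ]; exact Filter.univ_mem)
  have h2 := h1.comp t (hasMFDerivAt_iff_hasFDerivAt.2 hγ.hasFDerivAt)
  refine h2.congr_mfderiv ?_
  have h3 := mfderivWithin_extChartAt_symm_comp_mfderiv_extChartAt (I := 𝓡 (2 * n + 1)) ht
  refine ContinuousLinearMap.ext_ring ?_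
  have h4 := DFunLike.congr_fun h3 (X ((extChartAt (𝓡 (2 * n + 1)) x₀).symm (γ t)))
  have h5 : (1 : ℝ) • fieldRep X x₀ (γ t) = fieldRep X x₀ (γ t) := one_smul _ _
  have h6 : (1 : ℝ) • X ((extChartAt (𝓡 (2 * n + 1)) x₀).symm (γ t)) = X _ := one_smul _ _
  exact (congrArg (mfderivWithin 𝓘(ℝ, Model n) (𝓡 (2 * n + 1))
    (extChartAt (𝓡 (2 * n + 1)) x₀).symm (Set.range (𝓡 (2 * n + 1))) (γ t)) h5).trans
      (h4.trans h6.symm)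

/-- The order of an integrator can be read off in charts. -/
theorem hasOrder_of_hasOrderNear {S : ℝ → OpenPartialHomeomorph M M}
    {X : ∀ x : M, TangentSpace (𝓡 (2 * n + 1)) x} {p : ℕ}
    (h : ∀ x₀ : M, ∃ (V : Model n → Model n) (α : ℝ × Model n → Model n), IsFamilyAt S x₀ V ∧
      IsFlowNear (fieldRep X x₀) α (extChartAt (𝓡 (2 * n + 1)) x₀ x₀) ∧
      HasOrderNear α (extChartAt (𝓡 (2 * n + 1)) x₀ x₀) p (chartRep x₀ x₀ fun τ => S τ)) :
    HasOrder S X p := by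
  intro x₀
  obtain ⟨V, α, hS, hα, hO⟩ := h x₀
  set c := extChartAt (𝓡 (2 * n + 1)) x₀ with hc
  obtain ⟨C, hC⟩ := hO.bound
  have htc := tendsto_prodMk_extChartAt (n := n) x₀
  have hαt : ∀ᶠ q in 𝓝 ((0 : ℝ), c x₀), α q ∈ c.target :=
    hα.tendsto.eventually_mem (extChartAt_target_mem_nhds x₀)
  have hzero : ∀ᶠ q in 𝓝 ((0 : ℝ), c x₀), α (0, q.2) = q.2 :=
    (continuous_snd.tendsto' ((0 : ℝ), c x₀) (c x₀) rfl).eventually hα.eventually_zero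
  have hsrc : ∀ᶠ p in 𝓝 ((0 : ℝ), x₀), p.2 ∈ c.source :=
    (continuous_snd.tendsto' ((0 : ℝ), x₀) x₀ rfl).eventually_mem (extChartAt_source_mem_nhds x₀)
  have hall := (htc.eventually ((hα.eventually_hasDerivAt.and hαt).and (hzero.and hC))).and
    ((hS.eventually_mem.and hS.eventually_mem_source).and hsrc)
  -- All the needed conditions hold on a product neighbourhood, which yields one `δ` and one `C` for
  -- all `x` near `x₀`; `Φ` is `α` read back through the chart.
  rw [nhds_prod_eq] at hall
  obtain ⟨P, hP, Q, hQ, hPQ⟩ := eventually_prod_iff.1 hall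
  obtain ⟨δ, hδ, hball⟩ := Metric.eventually_nhds_iff_ball.1 hP
  rw [Real.ball_eq_Ioo, zero_sub, zero_add] at hball
  refine ⟨{x | Q x}, hQ, δ, hδ, C, fun t x => c.symm (α (t, c x)), fun x hx => ⟨?_, ?_, ?_⟩⟩
  · obtain ⟨⟨-, h2, -⟩, -, h6⟩ := hPQ hP.self_of_nhds hx
    exact (congrArg c.symm h2).trans (c.left_inv h6)
  · intro t ht
    obtain ⟨⟨⟨h1, h2⟩, -⟩, -⟩ := hPQ (hball t ht) hx
    exact (hasMFDerivAt_extChartAt_symm_comp (γ := fun t => α (t, c x)) h1 h2).hasMFDerivWithinAt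
  · intro t ht
    obtain ⟨⟨⟨-, h2⟩, -, h4⟩, ⟨h5, h6⟩, h7⟩ := hPQ (hball t ht) hx
    refine ⟨h5, h6, c.map_target h2, ?_⟩
    rw [c.right_inv h2]
    have h8 : ‖c (S t (c.symm (c x))) - α (t, c x)‖ ≤ C * ‖t ^ (p + 1)‖ := h4
    rwa [c.left_inv h7, norm_pow, Real.norm_eq_abs] at h8

end Families

/-! ### Symmetry of the splitting and the order of its iterated triple jump. -/

section Splitting

variable {n : ℕ} {M : Type*} [TopologicalSpace M]

/-- Inversion reverses the word and inverts each letter; the word is a palindrome, so only the sign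
of `τ` changes. -/
theorem splitting_neg {l : List (ℝ → OpenPartialHomeomorph M M)}
    (hl : ∀ e ∈ l, ∀ τ, e (-τ) = (e τ).symm) (τ : ℝ) :
    splitting l (-τ) = (splitting l τ).symm := by
  induction l with
  | nil => rfl
  | cons e l ih =>
    cases l with
    | nil => exact hl e (by simp) τ
    | cons e' l =>
      have h1 := ih fun a ha => hl a (List.mem_cons_of_mem _ ha)
      simp only [splitting, OpenPartialHomeomorph.trans_symm_eq_symm_trans_symm,
        OpenPartialHomeomorph.trans_assoc]
      rw [h1, neg_div, hl e (by simp)]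

/-- Applied to contactness and to having full source and target; `hrefl` covers the empty splitting.
-/
theorem splitting_induction {P : OpenPartialHomeomorph M M → Prop}
    (hrefl : P (OpenPartialHomeomorph.refl M)) (htrans : ∀ f g, P f → P g → P (f.trans g))
    {l : List (ℝ → OpenPartialHomeomorph M M)} (hl : ∀ e ∈ l, ∀ τ, P (e τ)) (τ : ℝ) :
    P (splitting l τ) := by
  induction l with
  | nil => exact hrefl
  | cons e l ih =>
    cases l with
    | nil => exact hl e (by simp) τ
    | cons e' l =>
      have h1 := ih fun a ha => hl a (List.mem_cons_of_mem _ ha)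
      have h2 := hl e (by simp) (τ / 2)
      exact htrans _ _ h2 (htrans _ _ h1 h2)

theorem tripleJump_induction {P : OpenPartialHomeomorph M M → Prop}
    (htrans : ∀ f g, P f → P g → P (f.trans g)) {S : ℝ → OpenPartialHomeomorph M M}
    (hS : ∀ τ, P (S τ)) (k : ℕ) (τ : ℝ) : P (tripleJump S k τ) := by
  induction k generalizing τ with
  | zero => exact hS τ
  | succ k ih => exact htrans _ _ (ih _) (htrans _ _ (ih _) (ih _))

theorem trans_source_target_eq_univ {f g : OpenPartialHomeomorph M M}
    (hf : f.source = Set.univ ∧ f.target = Set.univ)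
    (hg : g.source = Set.univ ∧ g.target = Set.univ) :
    (f.trans g).source = Set.univ ∧ (f.trans g).target = Set.univ := by
  rw [OpenPartialHomeomorph.trans_source, OpenPartialHomeomorph.trans_target, hf.1, hg.1, hf.2,
    hg.2]
  simp

variable [ChartedSpace (Model n) M]

theorem LocalFlow.exp_neg {Y : ∀ x : M, TangentSpace (𝓡 (2 * n + 1)) x} (F : LocalFlow Y) (t : ℝ) :
    F.exp (-t) = (F.exp t).symm := by
  refine OpenPartialHomeomorph.ext _ _ (fun _ => rfl) (fun x => ?_) rfl
  change F.toFun (- -t) x = F.toFun t x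
  rw [neg_neg]

/-- The iterated triple jump of a splitting integrator has order `2 k + 2`. -/
theorem hasOrder_tripleJump_splitting [IsManifold (𝓡 (2 * n + 1)) ∞ M] {N : ℕ}
    {X : ∀ x : M, TangentSpace (𝓡 (2 * n + 1)) x} (hX : IsSmoothField X)
    {Y : Fin N → ∀ x : M, TangentSpace (𝓡 (2 * n + 1)) x} (hXY : ∀ x, X x = ∑ j, Y j x)
    (F : ∀ j, LocalFlow (Y j)) (k : ℕ) :
    HasOrder (tripleJump (splitting (List.ofFn fun j => (F j).exp)) k) X (2 * k + 2) := by
  refine hasOrder_of_hasOrderNear fun x₀ => ?_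
  have hf : ContDiffAt ℝ ∞ (fieldRep X x₀) (extChartAt (𝓡 (2 * n + 1)) x₀ x₀) :=
    (contDiffOn_fieldRep hX x₀).contDiffAt (extChartAt_target_mem_nhds x₀)
  obtain ⟨α, hα⟩ := exists_isFlowNear (hf.of_le (show (1 : ℕ∞ω) ≤ ∞ by exact_mod_cast le_top))
  have hS : IsFamilyAt (splitting (List.ofFn fun j => (F j).exp)) x₀ (fieldRep X x₀) := by
    have h1 := IsFamilyAt.splitting (x₀ := x₀)
      (List.ofFn fun j => ((F j).exp, fieldRep (Y j) x₀)) (by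
        intro e he
        obtain ⟨j, rfl⟩ := (List.mem_ofFn' _ _).1 he
        exact IsFamilyAt.exp (F j) x₀)
    simp only [List.map_ofFn, Function.comp_def, List.sum_ofFn] at h1
    convert h1 using 1
    funext y
    have h2 : X ((extChartAt (𝓡 (2 * n + 1)) x₀).symm y) =
      ∑ j, Y j ((extChartAt (𝓡 (2 * n + 1)) x₀).symm y) := hXY _
    unfold fieldRep
    rw [h2]
    exact map_sum _ _ _
  have hsymm : ∀ τ, splitting (List.ofFn fun j => (F j).exp) (-τ) =
      (splitting (List.ofFn fun j => (F j).exp) τ).symm := splitting_neg (by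
    intro e he τ
    obtain ⟨j, rfl⟩ := (List.mem_ofFn' _ _).1 he
    exact (F j).exp_neg τ)
  obtain ⟨V', hk⟩ := hS.tripleJump k
  refine ⟨V', α, hk, hα, ?_⟩
  exact hasOrderNear_iterate_jump hf hα
    (fun k => chartRep x₀ x₀ fun τ => tripleJump (splitting (List.ofFn fun j => (F j).exp)) k τ)
    hS.isSmoothFamilyNear (hS.isSymmetricNear hsymm) hS.eventually_hasDerivAt
    (fun k => ⟨z₁ (k + 1), z₀ (k + 1), two_mul_z₁_add_z₀ k, two_mul_z₁_pow_add_z₀_pow k,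
      hS.chartRep_tripleJump_succ k⟩) k

end Splitting

end ContactIntegrator

/-! ### The main theorem, with `k + 1` in the role of the half-order. -/

theorem mainTheorem3 (k : ℕ) :
    ∃ (m : ℕ) (w : ℕ → ℝ), w 0 = 1 - 2 * ∑ j ∈ Finset.Icc 1 m, w j ∧
      ∀ (n N : ℕ) (M : Type*) [TopologicalSpace M] [T2Space M] [ChartedSpace (Model n) M]
        [IsManifold (𝓡 (2 * n + 1)) ∞ M]
        (η : ∀ x : M, TangentSpace (𝓡 (2 * n + 1)) x →L[ℝ] ℝ), IsContactForm η →
        ∀ (H : M → ℝ) (φ : Fin N → M → ℝ), (∀ x, H x = ∑ j, φ j x) →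
        ∀ (X : ∀ x : M, TangentSpace (𝓡 (2 * n + 1)) x), IsContactHamiltonianField η H X →
        ∀ (Y : Fin N → ∀ x : M, TangentSpace (𝓡 (2 * n + 1)) x),
          (∀ j, IsContactHamiltonianField η (φ j) (Y j)) →
        ∀ (F : ∀ j, LocalFlow (Y j)) (S₂ : ℝ → OpenPartialHomeomorph M M),
          S₂ = splitting (List.ofFn fun j => (F j).exp) →
          IsContactIntegrator η X (tripleJump S₂ k) (2 * k + 2) ∧
          IsContactIntegrator η X (symmetricComposition S₂ w m) (2 * k + 2) ∧
          ((∀ j, (F j).dom = Set.univ) → ∀ τ : ℝ,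
            ((tripleJump S₂ k τ).source = Set.univ ∧ (tripleJump S₂ k τ).target = Set.univ) ∧
            ((symmetricComposition S₂ w m τ).source = Set.univ ∧
              (symmetricComposition S₂ w m τ).target = Set.univ)) := by
  -- The weights come from the triple-jump coefficients alone, before any geometric data is
  -- introduced; with them the symmetric composition equals the triple jump (`heq`).
  obtain ⟨m, w, hw, hpal⟩ := exists_palindrome_eq_tripleJumpCoeffs k
  refine ⟨m, w, hw, ?_⟩
  intro n N M _ _ _ _ η hη H φ hH X hX Y hY F S₂ hS₂
  have heq : symmetricComposition S₂ w m = tripleJump S₂ k := by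
    funext τ
    rw [symmetricComposition_eq_listComposition, hpal, tripleJump_eq_listComposition]
  have hmain : IsContactIntegrator η X (tripleJump S₂ k) (2 * k + 2) := by
    subst hS₂
    refine ⟨hasOrder_tripleJump_splitting hX.smooth (hX.eq_sum hη hH hY) F k, fun τ => ?_⟩
    refine tripleJump_induction (fun _ _ hf hg => hf.trans hg) (fun τ => ?_) k τ
    refine splitting_induction (IsContactMap.refl η) (fun _ _ hf hg => hf.trans hg) ?_ τ
    intro e he τ
    obtain ⟨j, rfl⟩ := (List.mem_ofFn' _ _).1 he
    exact (F j).isContactMap_exp hη (hY j) τ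
  refine ⟨hmain, by rw [heq]; exact hmain, fun hdom τ => ?_⟩
  have huniv : (tripleJump S₂ k τ).source = Set.univ ∧ (tripleJump S₂ k τ).target = Set.univ := by
    subst hS₂
    refine tripleJump_induction (P := fun f => f.source = Set.univ ∧ f.target = Set.univ)
      (fun _ _ => trans_source_target_eq_univ) (fun τ => ?_) k τ
    refine splitting_induction (P := fun f => f.source = Set.univ ∧ f.target = Set.univ)
      ⟨rfl, rfl⟩ (fun _ _ => trans_source_target_eq_univ) ?_ τ
    intro e he τ
    obtain ⟨j, rfl⟩ := (List.mem_ofFn' _ _).1 he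
    constructor
    · exact Set.eq_univ_of_forall fun x => (by rw [hdom j]; trivial : (τ, x) ∈ (F j).dom)
    · exact Set.eq_univ_of_forall fun x => (by rw [hdom j]; trivial : (-τ, x) ∈ (F j).dom)
  exact ⟨huniv, by rw [heq]; exact huniv⟩
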